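/- **Setting.** Let $\Omega\subset\mathbb R^3$ be a bounded open set with $\Omega=\operatorname{int}\overline\Omega$, and let $\mathcal T$ be a finite family of non-overlapping closed elements with $\overline\Omega=\bigcup_{K\in\mathcal T}K$, each of which is the image $K=F_K(\hat K)$, under an invertible affine map $F_K$, of the reference hexahedron $[-1,1]^3$, the unit tetrahedron, or the wedge (unit triangle)$\,\times[-1,1]$. Let $\mathcal F_f$ be a finite set of faces; each $\varphi\in\mathcal F_f$ is a common (whole) face of two different elements $K^-_\varphi,K^+_\varphi\in\mathcal T$. Put $\Gamma_f=\bigcup_{\varphi\in\mathcal F_f}\varphi$, let $\Gamma_u\subset\partial\Omega$, and define * $\mathcal U=\{v\in H^1(\Omega\setminus\Gamma_f;\mathbb R^3): v=0 \text{ a.e. on }\Gamma_u\}$ (in the sense of traces), with $\|v\|_U^2=\operatorname{diam}(\Omega)^{-2}\|v\|_{L^2(\Omega)}^2+\|\nabla v\|_{L^2(\Omega\setminus\Gamma_f)}^2$; * the jump $[\![v]\!]=\gamma^+v-\gamma^-v$ on $\Gamma_f$, where $\gamma^\pm v|_\varphi\in L^2(\varphi)$ is the trace of $v|_{K^\pm_\varphi}$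 on $\varphi$; * $\mathcal U^{h,1}=\{v\in\mathcal U: v|_K\in[\mathbb X_1(K)]^3\ \forall K\in\mathcal T\}$, where $\mathbb X_1(K)=\{p\circ F_K^{-1}\}$ with $p$ trilinear (hexahedra), affine (tetrahedra), or in the tensor product of affine functions on the triangle and affine functions of the height (wedges); * $\mathcal U^b$, the span of the fields $b^{\pm}_{K,\varphi}\,e_i$ ($\varphi\in\mathcal F_f$, $i=1,2,3$), where $b^\pm_{K,\varphi}=\hat b\circ F_{K}^{-1}$ on $K=K^\pm_\varphi$ and $0$ elsewhere; here $\hat b$ is the bubble of the reference face $\hat\varphi=F_K^{-1}(\varphi)$: $\hat b=\frac12(1\pm\hat x_j)\prod_{i\ne j}(1-\hat x_i^2)$ for the face $\hat x_j=\pm1$ of the hexahedron; $\hat b=\prod_{i\ne j}\hat\lambda_i$ for the face of the tetrahedron opposite to vertex $j$; $\hat b=\frac12(1\pm\hat x_3)\hat\lambda_1\hat\lambda_2\hat\lambda_3$ for the triangular face $\hat x_3=\pm1$ of the wedge and $\hat b=(1-\hat x_3^2)\prod_{i\neq j}\hat\lambda_i$ for its quadrilateral face opposite to vertex $j$ of the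 triangle ($\hat\lambda_i$ are the barycentric coordinates of the tetrahedron, respectively of the triangle); * $\mathcal U^h=\mathcal U^{h,1}\oplus\mathcal U^b$; * $\mathcal M^h=\{\mu\in L^2(\Gamma_f;\mathbb R^3):\mu|_\varphi\text{ is constant }\forall\varphi\in\mathcal F_f\}$, and $b(\mu,v)=(\mu,[\![v]\!])_{\Gamma_f}=\int_{\Gamma_f}\mu\cdot[\![v]\!]\,d\Gamma$; * $\|\mu\|_{M}=\sup_{g}\,(\mu,g)_{\Gamma_f}/\|g\|_{1/2}$, the $H^{-1/2}(\Gamma_f)$-norm dual to the trace norm $\|g\|_{1/2}=\inf\{\|v\|_U: v\in\mathcal U,\ [\![v]\!]=g\}$, where $g\neq0$ ranges over the jumps of elements of $\mathcal U$. **Theorem.** Let $C>0$ and suppose that there is a linear operator $\Pi_h:\mathcal U\to\mathcal U^h$ such that $$b(\mu,\Pi_hu-u)=0\quad\forall\mu\in\mathcal M^h,\ \forall u\in\mathcal U,\qquad\text{and}\qquad \|\Pi_hu\|_U\le C\|u\|_U\quad\forall u\in\mathcal U.$$ Then the discrete inf-sup condition holds with $\beta=C^{-1}$: $$\inf_{0\ne\mu\in\mathcal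 M^h}\ \sup_{0\ne v\in\mathcal U^h}\ \frac{b(\mu,v)}{\|v\|_U\,\|\mu\|_{M}}\ \ge\ C^{-1}>0 .$$ -/

import Mathlib

open MeasureTheory Set
open scoped ENNReal RealInnerProductSpace

noncomputable section

namespace FaultFEM

/-- Three-dimensional Euclidean space. -/
abbrev E : Type := EuclideanSpace ℝ (Fin 3)

/-- The `j`-th vector of the standard basis. -/
def e (j : Fin 3) : E := EuclideanSpace.single j 1

/-! ### Reference elements, shape functions, face bubbles -/

/-- The three kinds of elements. -/
inductive CellKind
  | hex
  | tet
  | wedge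

/-- The two signs / the two sides of the contact surface. -/
inductive Side
  | minus
  | plus

/-- The number `-1` or `+1`. -/
def Side.sign : Side → ℝ
  | .minus => -1
  | .plus => 1

/-- Barycentric coordinates on the unit tetrahedron. -/
def tetBary (j : Fin 4) (x : E) : ℝ := ![1 - x 0 - x 1 - x 2, x 0, x 1, x 2] j

/-- Barycentric coordinates on the unit triangle in the first two variables. -/
def triBary (j : Fin 3) (x : E) : ℝ := ![1 - x 0 - x 1, x 0, x 1] j

/-- The (closed) reference elements: the cube `[-1,1]³`, the unit tetrahedron, and the wedge
`(unit triangle) × [-1,1]`. -/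
def refCell : CellKind → Set E
  | .hex => {x | ∀ i, |x i| ≤ 1}
  | .tet => {x | ∀ j, 0 ≤ tetBary j x}
  | .wedge => {x | (∀ j, 0 ≤ triBary j x) ∧ |x 2| ≤ 1}

/-- Labels of the faces of a reference element: `hex j s` lies in `{x_j = s}`, `tet j` is opposite
to the vertex `j`, `wedgeTri s` lies in `{x_3 = s}`, and `wedgeQuad j` is the quadrilateral
opposite to the vertex `j` of the triangle. -/
inductive RefFace : CellKind → Type
  | hex (j : Fin 3) (s : Side) : RefFace .hex
  | tet (j : Fin 4) : RefFace .tet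
  | wedgeTri (s : Side) : RefFace .wedge
  | wedgeQuad (j : Fin 3) : RefFace .wedge

/-- The (closed) face of the reference element with a given label. -/
def RefFace.toSet : {k : CellKind} → RefFace k → Set E
  | _, .hex j s => {x ∈ refCell .hex | x j = s.sign}
  | _, .tet j => {x ∈ refCell .tet | tetBary j x = 0}
  | _, .wedgeTri s => {x ∈ refCell .wedge | x 2 = s.sign}
  | _, .wedgeQuad j => {x ∈ refCell .wedge | triBary j x = 0}

/-- The face bubble functions on the reference elements (as polynomials on the whole space). -/
def RefFace.bubble : {k : CellKind} → RefFace k → E → ℝ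
  | _, .hex j s => fun x => (1 / 2) * (1 + s.sign * x j) * ∏ i ∈ Finset.univ.erase j, (1 - x i ^ 2)
  | _, .tet j => fun x => ∏ i ∈ Finset.univ.erase j, tetBary i x
  | _, .wedgeTri s => fun x => (1 / 2) * (1 + s.sign * x 2) * ∏ i, triBary i x
  | _, .wedgeQuad j => fun x => (1 - x 2 ^ 2) * ∏ i ∈ Finset.univ.erase j, triBary i x

/-- The sets of variables whose product is a monomial of the local space: all of them for the
trilinear functions on the cube, at most one variable for the linear functions on the tetrahedron,
and not both triangle variables for (linear on the triangle) ⊗ (linear in the height). -/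
def shapeMonomials : CellKind → Set (Finset (Fin 3))
  | .hex => univ
  | .tet => {S | S.card ≤ 1}
  | .wedge => {S | ¬ ({0, 1} : Finset (Fin 3)) ⊆ S}

/-- The local space on the reference element: `Q₁`, `P₁`, or `P₁ ⊗ P₁`. -/
def refShape (k : CellKind) : Submodule ℝ (E → ℝ) :=
  Submodule.span ℝ ((fun (S : Finset (Fin 3)) (x : E) => ∏ i ∈ S, x i) '' shapeMonomials k)

/-! ### Sobolev functions and traces -/

/-- Square integrable vector fields on `O`. -/
abbrev L2 (O : Set E) : Type := Lp E 2 ((volume : Measure E).restrict O)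

/-- Square integrable vector fields on the surface `S`, for the surface measure. -/
abbrev L2Surf (S : Set E) : Type := Lp E 2 ((μHE[2] : Measure E).restrict S)

/-- Pairs of a vector field `u` and a candidate for the list `(∂₁u, ∂₂u, ∂₃u)`. -/
abbrev Pair (O : Set E) : Type := L2 O × (Fin 3 → L2 O)

/-- `g` is the weak `j`-th partial derivative of `v` in the open set `O`. -/
def HasWeakPartial (O : Set E) (j : Fin 3) (v g : L2 O) : Prop :=
  ∀ ψ : E → ℝ, ContDiff ℝ (⊤ : ℕ∞) ψ → HasCompactSupport ψ → tsupport ψ ⊆ O →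
    ∫ x in O, fderiv ℝ ψ x (e j) • v x = - ∫ x in O, ψ x • g x

theorem integrable_smul_of_compactSupport {O : Set E} {ψ : E → ℝ} (hψ : Continuous ψ)
    (hc : HasCompactSupport ψ) (v : L2 O) :
    Integrable (fun x => ψ x • v x) ((volume : Measure E).restrict O) := by
  have h1 : MemLp ψ 2 ((volume : Measure E).restrict O) := hψ.memLp_of_hasCompactSupport hc
  have h2 : MemLp (fun x => ψ x • v x) 1 ((volume : Measure E).restrict O) := (Lp.memLp v).smul h1
  exact memLp_one_iff_integrable.1 h2

theorem integrable_fderiv_smul {O : Set E} {ψ : E → ℝ} (hψ : ContDiff ℝ (⊤ : ℕ∞) ψ)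
    (hc : HasCompactSupport ψ) (j : Fin 3) (v : L2 O) :
    Integrable (fun x => fderiv ℝ ψ x (e j) • v x) ((volume : Measure E).restrict O) := by
  refine integrable_smul_of_compactSupport (ψ := fun x => fderiv ℝ ψ x (e j)) ?_ ?_ v
  · exact (hψ.continuous_fderiv (by simp)).clm_apply continuous_const
  · exact hc.fderiv_apply (𝕜 := ℝ) (e j)

theorem HasWeakPartial.add {O : Set E} {j : Fin 3} {v g v' g' : L2 O}
    (h : HasWeakPartial O j v g) (h' : HasWeakPartial O j v' g') :
    HasWeakPartial O j (v + v') (g + g') := by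
  intro ψ hψ hc hs
  have e1 : ∫ x in O, fderiv ℝ ψ x (e j) • (v + v' : L2 O) x
      = ∫ x in O, (fderiv ℝ ψ x (e j) • v x + fderiv ℝ ψ x (e j) • v' x) := by
    refine integral_congr_ae ?_
    filter_upwards [Lp.coeFn_add v v'] with x hx
    rw [hx, Pi.add_apply, smul_add]
  have e2 : ∫ x in O, ψ x • (g + g' : L2 O) x = ∫ x in O, (ψ x • g x + ψ x • g' x) := by
    refine integral_congr_ae ?_
    filter_upwards [Lp.coeFn_add g g'] with x hx
    rw [hx, Pi.add_apply, smul_add]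
  rw [e1, e2, integral_add (integrable_fderiv_smul hψ hc j v) (integrable_fderiv_smul hψ hc j v'),
    integral_add (integrable_smul_of_compactSupport hψ.continuous hc g)
      (integrable_smul_of_compactSupport hψ.continuous hc g'), h ψ hψ hc hs, h' ψ hψ hc hs, neg_add]

theorem HasWeakPartial.smul {O : Set E} {j : Fin 3} {v g : L2 O} (c : ℝ)
    (h : HasWeakPartial O j v g) : HasWeakPartial O j (c • v) (c • g) := by
  intro ψ hψ hc hs
  have e1 : ∫ x in O, fderiv ℝ ψ x (e j) • (c • v : L2 O) x
      = ∫ x in O, c • (fderiv ℝ ψ x (e j) • v x) := by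
    refine integral_congr_ae ?_
    filter_upwards [Lp.coeFn_smul c v] with x hx
    simp only [hx, Pi.smul_apply]
    rw [smul_comm]
  have e2 : ∫ x in O, ψ x • (c • g : L2 O) x = ∫ x in O, c • (ψ x • g x) := by
    refine integral_congr_ae ?_
    filter_upwards [Lp.coeFn_smul c g] with x hx
    simp only [hx, Pi.smul_apply]
    rw [smul_comm]
  rw [e1, e2, integral_smul, integral_smul, h ψ hψ hc hs, smul_neg]

theorem hasWeakPartial_zero (O : Set E) (j : Fin 3) : HasWeakPartial O j 0 0 := by
  intro ψ hψ hc hs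
  have h := (integral_eq_zero_of_ae (μ := (volume : Measure E).restrict O)
    (f := fun x => fderiv ℝ ψ x (e j) • (0 : L2 O) x) (by
      filter_upwards [Lp.coeFn_zero E 2 ((volume : Measure E).restrict O)] with x hx
      simp only [hx, Pi.zero_apply, smul_zero]))
  have h' := (integral_eq_zero_of_ae (μ := (volume : Measure E).restrict O)
    (f := fun x => ψ x • (0 : L2 O) x) (by
      filter_upwards [Lp.coeFn_zero E 2 ((volume : Measure E).restrict O)] with x hx
      simp only [hx, Pi.zero_apply, smul_zero]))
  rw [h, h', neg_zero]

/-- Square integrable vector fields on the part of `O` in the element `K`. -/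
abbrev L2On (O K : Set E) : Type := Lp E 2 (((volume : Measure E).restrict O).restrict K)

/-- Restriction of fields from `O` to `K`. -/
abbrev restr (O K : Set E) : L2 O →L[ℝ] L2On O K :=
  LpToLpRestrictCLM E E ℝ ((volume : Measure E).restrict O) 2 K

/-- Smooth fields on the whole space, seen through their values in `K`, their partial derivatives
in `K` and their values on the face `φ`. -/
def smoothTraceGraph (O K φ : Set E) :
    Submodule ℝ (L2On O K × (Fin 3 → L2On O K) × L2Surf φ) where
  carrier := {p | ∃ f : E → E, ContDiff ℝ (⊤ : ℕ∞) f ∧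
    (p.1 =ᵐ[(volume.restrict O).restrict K] f) ∧
    (∀ j, p.2.1 j =ᵐ[(volume.restrict O).restrict K] fun x => fderiv ℝ f x (e j)) ∧
    (p.2.2 =ᵐ[μHE[2].restrict φ] f)}
  add_mem' := by
    rintro p q ⟨f, hf, h1, h2, h3⟩ ⟨g, hg, k1, k2, k3⟩
    refine ⟨f + g, hf.add hg, ?_, fun j => ?_, ?_⟩
    · exact (Lp.coeFn_add _ _).trans (h1.add k1)
    · refine (Lp.coeFn_add _ _).trans (((h2 j).add (k2 j)).trans (Filter.Eventually.of_forall ?_))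
      intro x
      have hf' := (hf.differentiable (by simp)) x
      have hg' := (hg.differentiable (by simp)) x
      simp [fderiv_add hf' hg']
    · exact (Lp.coeFn_add _ _).trans (h3.add k3)
  zero_mem' := by
    refine ⟨0, contDiff_const, Lp.coeFn_zero _ _ _, fun j => ?_, Lp.coeFn_zero _ _ _⟩
    refine (Lp.coeFn_zero _ _ _).trans (Filter.Eventually.of_forall ?_)
    intro x
    simp
  smul_mem' := by
    rintro c p ⟨f, hf, h1, h2, h3⟩
    refine ⟨c • f, hf.const_smul c, ?_, fun j => ?_, ?_⟩
    · exact (Lp.coeFn_smul _ _).trans (h1.const_smul c)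
    · refine (Lp.coeFn_smul _ _).trans
        (((h2 j).const_smul c).trans (Filter.Eventually.of_forall ?_))
      intro x
      have hf' := (hf.differentiable (by simp)) x
      simp [fderiv_const_smul hf']
    · exact (Lp.coeFn_smul _ _).trans (h3.const_smul c)

/-- `g ∈ L²(φ)` is the trace on the face `φ`, taken from inside `K`, of the `H¹` field `w`: there
are smooth fields that converge to `w` in `H¹(K)` and whose restrictions to `φ` converge to `g` in
`L²(φ)`. -/
def IsTrace {O : Set E} (K φ : Set E) (w : Pair O) (g : L2Surf φ) : Prop :=
  (restr O K w.1, (fun j => restr O K (w.2 j)), g) ∈ (smoothTraceGraph O K φ).topologicalClosure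

theorem IsTrace.add {O K φ : Set E} {w w' : Pair O} {g g' : L2Surf φ} (h : IsTrace K φ w g)
    (h' : IsTrace K φ w' g') : IsTrace K φ (w + w') (g + g') := by
  have := add_mem h h'
  simpa [IsTrace, Pi.add_def] using this

theorem IsTrace.smul {O K φ : Set E} {w : Pair O} {g : L2Surf φ} (c : ℝ) (h : IsTrace K φ w g) :
    IsTrace K φ (c • w) (c • g) := by
  have := Submodule.smul_mem _ c h
  simpa [IsTrace, Pi.smul_def] using this

theorem isTrace_zero {O : Set E} (K φ : Set E) : IsTrace K φ (0 : Pair O) 0 := by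
  have h := zero_mem (smoothTraceGraph O K φ).topologicalClosure
  unfold IsTrace
  convert h using 1
  simp only [Prod.fst_zero, Prod.snd_zero, Pi.zero_apply, map_zero]
  rfl

open Classical in
/-- The trace on the face `φ` from inside `K` (it exists and is unique for `H¹` fields on an
element `K` with face `φ`). -/
def trace {O : Set E} (K φ : Set E) (w : Pair O) : L2Surf φ :=
  if h : ∃ g, IsTrace K φ w g then h.choose else 0

/-! ### The mesh and the contact surface -/

/-- A polyhedral domain with an affine mesh of hexahedra, tetrahedra and wedges, indexed by `ι`,
a family of faces indexed by `κ` that form the contact surface, and the Dirichlet part of the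
boundary. -/
structure FaultMesh (ι κ : Type*) where
  /-- the domain -/
  Ω : Set E
  /-- the type of each element -/
  kind : ι → CellKind
  /-- the affine map from the reference element onto each element -/
  map : ι → E ≃ᵃ[ℝ] E
  /-- the domain is a regular open set -/
  interior_closure : interior (closure Ω) = Ω
  /-- the elements fill the closed domain -/
  closure_eq : closure Ω = ⋃ K, map K '' refCell (kind K)
  /-- the elements do not overlap -/
  nonoverlapping : ∀ K K', K ≠ K' →
    Disjoint (interior (map K '' refCell (kind K))) (interior (map K' '' refCell (kind K')))
  /-- the element on each side of a face of the contact surface -/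
  side : Side → κ → ι
  /-- the label of that face in the element on either side -/
  sideFace : ∀ (s : Side) (φ : κ), RefFace (kind (side s φ))
  /-- the elements on the two sides are different -/
  side_ne : ∀ φ, side .minus φ ≠ side .plus φ
  /-- the two elements share the whole face -/
  face_eq : ∀ φ, map (side .minus φ) '' (sideFace .minus φ).toSet =
    map (side .plus φ) '' (sideFace .plus φ).toSet
  /-- different indices give different faces -/
  face_injective : Function.Injective fun φ => map (side .plus φ) '' (sideFace .plus φ).toSet
  /-- the Dirichlet part of the boundary -/
  Γu : Set E
  /-- it is part of the boundary -/
  Γu_subset : Γu ⊆ frontier Ω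

namespace FaultMesh

variable {ι κ : Type*} (T : FaultMesh ι κ)

/-- The element with index `K`. -/
def cell (K : ι) : Set E := T.map K '' refCell (T.kind K)

/-- A face of the element `K`. -/
def cellFace (K : ι) (f : RefFace (T.kind K)) : Set E := T.map K '' f.toSet

/-- The face of the contact surface with index `φ`. -/
def face (φ : κ) : Set E := T.map (T.side .plus φ) '' (T.sideFace .plus φ).toSet

/-- The contact surface. -/
def Γf : Set E := ⋃ φ, T.face φ

theorem face_subset (φ : κ) : T.face φ ⊆ T.Γf := subset_iUnion T.face φ

/-- The domain cut along the contact surface. -/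
def O : Set E := T.Ω \ T.Γf

/-- The displacement space: the `H¹` fields on the cut domain, each represented by the field
together with its weak partial derivatives, whose trace vanishes on the Dirichlet boundary. -/
def U : Submodule ℝ (Pair T.O) where
  carrier := {w | (∀ j, HasWeakPartial T.O j w.1 (w.2 j)) ∧
    ∀ (K : ι) (f : RefFace (T.kind K)), ∃ g : L2Surf (T.cellFace K f),
      IsTrace (T.cell K) (T.cellFace K f) w g ∧
      ∀ᵐ x ∂(μHE[2].restrict (T.cellFace K f)), x ∈ T.Γu → g x = 0}
  add_mem' := by
    rintro w w' ⟨h1, h2⟩ ⟨k1, k2⟩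
    refine ⟨fun j => (h1 j).add (k1 j), fun K f => ?_⟩
    obtain ⟨g, hg, hg0⟩ := h2 K f
    obtain ⟨g', hg', hg0'⟩ := k2 K f
    refine ⟨g + g', hg.add hg', ?_⟩
    filter_upwards [hg0, hg0', Lp.coeFn_add g g'] with x hx hx' hadd hxu
    rw [hadd, Pi.add_apply, hx hxu, hx' hxu, add_zero]
  zero_mem' := by
    refine ⟨fun j => hasWeakPartial_zero _ j, fun K f => ⟨0, isTrace_zero _ _, ?_⟩⟩
    filter_upwards [Lp.coeFn_zero E 2 (μHE[2].restrict (T.cellFace K f))] with x hx _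
    rw [hx, Pi.zero_apply]
  smul_mem' := by
    rintro c w ⟨h1, h2⟩
    refine ⟨fun j => (h1 j).smul c, fun K f => ?_⟩
    obtain ⟨g, hg, hg0⟩ := h2 K f
    refine ⟨c • g, hg.smul c, ?_⟩
    filter_upwards [hg0, Lp.coeFn_smul c g] with x hx hs hxu
    simp [hs, hx hxu]

/-- The continuous piecewise (tri)linear displacements. -/
def Uh1 : Submodule ℝ (Pair T.O) where
  carrier := {w | w ∈ T.U ∧ ∀ (K : ι) (i : Fin 3), ∃ p ∈ refShape (T.kind K),
    ∀ᵐ x ∂((volume.restrict T.O).restrict (T.cell K)), w.1 x i = p ((T.map K).symm x)}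
  add_mem' := by
    rintro w w' ⟨h1, h2⟩ ⟨k1, k2⟩
    refine ⟨add_mem h1 k1, fun K i => ?_⟩
    obtain ⟨p, hp, hpx⟩ := h2 K i
    obtain ⟨q, hq, hqx⟩ := k2 K i
    refine ⟨p + q, add_mem hp hq, ?_⟩
    filter_upwards [hpx, hqx, ae_restrict_of_ae (Lp.coeFn_add w.1 w'.1)] with x hx hx' hadd
    rw [Prod.fst_add, hadd, Pi.add_apply, PiLp.add_apply, hx, hx', Pi.add_apply]
  zero_mem' := by
    refine ⟨zero_mem _, fun K i => ⟨0, zero_mem _, ?_⟩⟩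
    filter_upwards [ae_restrict_of_ae (Lp.coeFn_zero E 2 (volume.restrict T.O))] with x hx
    rw [Prod.fst_zero, hx, Pi.zero_apply, PiLp.zero_apply, Pi.zero_apply]
  smul_mem' := by
    rintro c w ⟨h1, h2⟩
    refine ⟨Submodule.smul_mem _ c h1, fun K i => ?_⟩
    obtain ⟨p, hp, hpx⟩ := h2 K i
    refine ⟨c • p, Submodule.smul_mem _ c hp, ?_⟩
    filter_upwards [hpx, ae_restrict_of_ae (Lp.coeFn_smul c w.1)] with x hx hs
    simp [hs, hx]

/-- The bubble function of the face `φ` in the element on the side `s`, extended by zero. -/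
def bubble (s : Side) (φ : κ) : E → ℝ :=
  (T.cell (T.side s φ)).indicator fun x =>
    (T.sideFace s φ).bubble ((T.map (T.side s φ)).symm x)

/-- The bubble space: the span of the vector valued two-sided face bubbles. -/
def Ub : Submodule ℝ (Pair T.O) :=
  Submodule.span ℝ {w | w ∈ T.U ∧ ∃ (s : Side) (φ : κ) (i : Fin 3),
    w.1 =ᵐ[volume.restrict T.O] fun x => T.bubble s φ x • e i}

/-- The enriched displacement space. -/
def Uh : Submodule ℝ (Pair T.O) := T.Uh1 ⊔ T.Ub

/-- The scaled (broken) `H¹` norm. -/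
def normU (w : Pair T.O) : ℝ :=
  Real.sqrt ((Metric.diam T.Ω) ^ (-2 : ℤ) * ‖w.1‖ ^ 2 + ∑ j, ‖w.2 j‖ ^ 2)

/-- The trace on the face `φ` of the contact surface from the side `s`. -/
def sideTrace (s : Side) (φ : κ) (w : Pair T.O) : L2Surf (T.face φ) :=
  trace (T.cell (T.side s φ)) (T.face φ) w

/-- The jump across the contact surface. -/
def jump [Fintype κ] (w : Pair T.O) (x : E) : E :=
  ∑ φ, (T.face φ).indicator (fun y => T.sideTrace .plus φ w y - T.sideTrace .minus φ w y) x

/-- The piecewise constant tractions. -/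
def Mh : Submodule ℝ (L2Surf T.Γf) where
  carrier := {μ | ∀ φ : κ, ∃ c : E, ∀ᵐ x ∂(μHE[2].restrict (T.face φ)), μ x = c}
  add_mem' := by
    intro μ ν hμ hν φ
    obtain ⟨c, hc⟩ := hμ φ
    obtain ⟨d, hd⟩ := hν φ
    have h := ae_restrict_of_ae_restrict_of_subset (T.face_subset φ) (Lp.coeFn_add μ ν)
    refine ⟨c + d, ?_⟩
    filter_upwards [hc, hd, h] with x hx hx' hadd
    rw [hadd, Pi.add_apply, hx, hx']
  zero_mem' := by
    intro φ
    refine ⟨0, ?_⟩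
    exact ae_restrict_of_ae_restrict_of_subset (T.face_subset φ)
      (Lp.coeFn_zero E 2 (μHE[2].restrict T.Γf))
  smul_mem' := by
    intro c μ hμ φ
    obtain ⟨d, hd⟩ := hμ φ
    have h := ae_restrict_of_ae_restrict_of_subset (T.face_subset φ) (Lp.coeFn_smul c μ)
    refine ⟨c • d, ?_⟩
    filter_upwards [hd, h] with x hx hs
    simp [hs, hx]

/-- The `L²` product on the contact surface. -/
def pairing (μ : L2Surf T.Γf) (g : E → E) : ℝ :=
  ∫ x in T.Γf, ⟪μ x, g x⟫ ∂μHE[2]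

/-- The bilinear form `b(μ, u) = (μ, ⟦u⟧)`. -/
def b [Fintype κ] (μ : L2Surf T.Γf) (w : Pair T.O) : ℝ := T.pairing μ (T.jump w)

/-- The space `H^{1/2}` of the contact surface: the jumps of displacements. -/
def jumpSpace [Fintype κ] : Set (L2Surf T.Γf) :=
  {g | ∃ u ∈ T.U, g =ᵐ[μHE[2].restrict T.Γf] T.jump u}

/-- The norm of `H^{1/2}`: the least norm of a displacement with the given jump. -/
def halfNorm [Fintype κ] (g : L2Surf T.Γf) : ℝ :=
  sInf {r | ∃ u ∈ T.U, g =ᵐ[μHE[2].restrict T.Γf] T.jump u ∧ r = T.normU u}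

/-- The norm of the tractions: the norm of `H^{-1/2}`, dual to the one of `H^{1/2}`. -/
def normM [Fintype κ] (μ : L2Surf T.Γf) : ℝ :=
  sSup {r | ∃ g ∈ T.jumpSpace, r = T.pairing μ g / T.halfNorm g}

/-- The discrete inf-sup condition with constant `β` for the pair of the enriched displacements
and the piecewise constant tractions; infimum and supremum are taken in the extended reals. -/
def InfSup [Fintype κ] (β : ℝ) : Prop :=
  0 < β ∧ (β : EReal) ≤
    ⨅ μ : {μ : L2Surf T.Γf // μ ∈ T.Mh ∧ μ ≠ 0}, ⨆ v : {v : Pair T.O // v ∈ T.Uh ∧ v ≠ 0},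
      ((T.b μ.1 v.1 / (T.normU v.1 * T.normM μ.1) : ℝ) : EReal)

end FaultMesh

end FaultFEM

end

noncomputable section

namespace FaultFEM

/-- The orthogonal Fubini formula in a normal form: `w` spans the orthogonal complement of `s`. -/
theorem lintegral_eq_lintegral_slices (s : Submodule ℝ E) (hs : Module.finrank ℝ s = 2) (p : E)
    {w : E} (hw : w ∈ sᗮ) (hw0 : w ≠ 0) {g : E → ℝ≥0∞} (hg : Measurable g) :
    ∫⁻ x, g x = ‖w‖ₑ * ∫⁻ t : ℝ, ∫⁻ z : s, g ((z : E) + t • w + p) := by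
  have h3 : Module.finrank ℝ E = 3 := by simp
  have hs' : Module.finrank ℝ sᗮ = 1 := by
    have := s.finrank_add_finrank_orthogonal
    omega
  have hmp := s.measurePreserving_measurableEquivProd p
  rw [InnerProductSpace.euclideanHausdorffMeasure_eq_volume] at hmp
  have hsymm := hmp.symm
  rw [← hsymm.lintegral_comp hg, Measure.volume_eq_prod, lintegral_prod_symm]
  · let w' : sᗮ := ⟨w, hw⟩
    have hw' : w' ≠ 0 := by simpa [w', Subtype.ext_iff] using hw0
    have hv := volume_eq_of_finrank_eq_one hs' hw'
    have hm : Measurable fun y : sᗮ => ∫⁻ z : s, g ((s.measurableEquivProd p).symm (z, y)) := by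
      apply Measurable.lintegral_prod_left' (f := fun q => g ((s.measurableEquivProd p).symm q))
      exact hg.comp (s.measurableEquivProd p).symm.measurable
    rw [hv, lintegral_smul_measure, lintegral_map hm]
    · simp [w']
      rfl
    · fun_prop
  · exact (hg.comp (s.measurableEquivProd p).symm.measurable).aemeasurable

theorem lintegral_comp_smul_add (s : Submodule ℝ E) (hs : Module.finrank ℝ s = 2) {r : ℝ}
    (hr : r ≠ 0) (a : s) {g : s → ℝ≥0∞} (hg : Measurable g) :
    ∫⁻ z, g (r • z + a) = ENNReal.ofReal |(r ^ 2)⁻¹| * ∫⁻ z, g z := by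
  have h1 : ∫⁻ z, g (r • z + a) = ∫⁻ z, g (z + a) ∂(Measure.map (r • ·) volume) := by
    rw [lintegral_map (by fun_prop) (by fun_prop)]
  rw [h1, Measure.map_addHaar_smul _ hr, lintegral_smul_measure, hs, lintegral_add_right_eq_self]
  rfl

theorem map_hyperplane (s : Submodule ℝ E) (hs : Module.finrank ℝ s = 2) (p : E) :
    Measure.map (fun z : s => (z : E) + p) volume
      = (μHE[2] : Measure E).restrict (range fun z : s => (z : E) + p) := by
  have hi : Isometry fun z : s => (z : E) + p := by
    intro x y
    simp
    rfl
  rw [← hi.map_euclideanHausdorffMeasure, ← hs, InnerProductSpace.euclideanHausdorffMeasure_eq_volume]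

/-- Integration over the cone with apex `c` over a plane: the truncated cone has a bounded
Jacobian. -/
theorem lintegral_cone_le (s : Submodule ℝ E) (hs : Module.finrank ℝ s = 2) (p c : E)
    (hc : c - p ∉ s) : ∃ A : ℝ≥0∞, A ≠ ∞ ∧ ∀ g : E → ℝ≥0∞, Measurable g →
      ∫⁻ y in range (fun z : s => (z : E) + p), (∫⁻ t in Ioo (0 : ℝ) (1 / 2),
        g ((1 - t) • y + t • c)) ∂μHE[2] ≤ A * ∫⁻ x, g x := by
  obtain ⟨a, ha, w, hw, haw⟩ := s.exists_add_mem_mem_orthogonal (c - p)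
  have hw0 : w ≠ 0 := by
    rintro rfl
    exact hc (by rw [haw]; simpa using ha)
  refine ⟨4 * ‖w‖ₑ⁻¹, ?_, fun g hg => ?_⟩
  · exact ENNReal.mul_ne_top (by simp) (by simpa using hw0)
  have hcc : c = a + w + p := by rw [← haw]; simp
  rw [← map_hyperplane s hs p, lintegral_map, lintegral_lintegral_swap]
  · have hfub := lintegral_eq_lintegral_slices s hs p hw hw0 hg
    calc ∫⁻ t in Ioo (0 : ℝ) (1 / 2), ∫⁻ z : s, g ((1 - t) • ((z : E) + p) + t • c)
        ≤ ∫⁻ t in Ioo (0 : ℝ) (1 / 2), 4 * ∫⁻ z : s, g ((z : E) + t • w + p) := by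
          refine setLIntegral_mono' measurableSet_Ioo fun t ht => ?_
          have h1 : ∀ z : s, g ((1 - t) • ((z : E) + p) + t • c)
              = (fun z : s => g ((z : E) + t • w + p)) ((1 - t) • z + t • ⟨a, ha⟩) := by
            intro z
            simp only [hcc, Submodule.coe_add, Submodule.coe_smul]
            congr 1
            module
          simp only [h1]
          have h2 := lintegral_comp_smul_add s hs (r := 1 - t) (by linarith [ht.2]) (t • ⟨a, ha⟩)
            (g := fun z : s => g ((z : E) + t • w + p)) (by fun_prop)
          rw [h2]
          gcongr
          rw [abs_of_nonneg (by positivity), ← ENNReal.ofReal_ofNat]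
          apply ENNReal.ofReal_le_ofReal
          rw [inv_le_comm₀ (by nlinarith [ht.2]) (by norm_num)]
          nlinarith [ht.2]
      _ ≤ ∫⁻ t : ℝ, 4 * ∫⁻ z : s, g ((z : E) + t • w + p) := setLIntegral_le_lintegral _ _
      _ = 4 * ‖w‖ₑ⁻¹ * ∫⁻ x, g x := by
          rw [lintegral_const_mul' _ _ (by simp), hfub, mul_assoc, ← mul_assoc ‖w‖ₑ⁻¹,
            ENNReal.inv_mul_cancel (by simpa using hw0) (by simp), one_mul]
  · apply Measurable.aemeasurable
    fun_prop
  · apply Measurable.lintegral_prod_right' (f := fun q : E × ℝ => g ((1 - q.2) • q.1 + q.2 • c))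
    fun_prop
  · fun_prop

theorem norm_clm_sq_le (A : E →L[ℝ] E) (v : E) :
    ‖A v‖ ^ 2 ≤ ‖v‖ ^ 2 * ∑ j, ‖A (e j)‖ ^ 2 := by
  have hv : v = ∑ j, v j • e j := by
    ext i
    simp [e, Fin.sum_univ_three]
    fin_cases i <;> simp
  have h1 : ‖A v‖ ≤ ∑ j, ‖v j‖ * ‖A (e j)‖ := by
    conv_lhs => rw [hv, map_sum]
    refine (norm_sum_le _ _).trans (le_of_eq ?_)
    simp [norm_smul]
  calc ‖A v‖ ^ 2 ≤ (∑ j, ‖v j‖ * ‖A (e j)‖) ^ 2 := by gcongr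
    _ ≤ (∑ j, ‖v j‖ ^ 2) * ∑ j, ‖A (e j)‖ ^ 2 := Finset.sum_mul_sq_le_sq_mul_sq _ _ _
    _ = _ := by rw [EuclideanSpace.norm_sq_eq]

/-- The value at `y` is controlled by the values on the first half of the segment from `y` to
`c`. -/
theorem norm_sq_le_integral_segment {f : E → E} (hf : ContDiff ℝ (⊤ : ℕ∞) f) (y c : E) :
    ‖f y‖ ^ 2 ≤ ∫ t in (0 : ℝ)..(1 / 2), (3 * ‖f ((1 - t) • y + t • c)‖ ^ 2
      + ‖fderiv ℝ f ((1 - t) • y + t • c) (c - y)‖ ^ 2) := by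
  set P : ℝ → E := fun t => (1 - t) • y + t • c with hP
  have hPc : Continuous P := by fun_prop
  have hdf : Continuous fun x => fderiv ℝ f x := hf.continuous_fderiv (by simp)
  have hfc := hf.continuous
  have hPd : ∀ t, HasDerivAt P (c - y) t := by
    intro t
    have h1 : HasDerivAt (fun t : ℝ => (1 - t) • y) ((-1 : ℝ) • y) t :=
      ((hasDerivAt_id t).const_sub 1).smul_const y
    have h2 : HasDerivAt (fun t : ℝ => t • c) ((1 : ℝ) • c) t := (hasDerivAt_id t).smul_const c
    refine (h1.add h2).congr_deriv ?_
    module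
  have hfd : ∀ t, HasDerivAt (fun t => f (P t)) (fderiv ℝ f (P t) (c - y)) t := fun t =>
    ((hf.differentiable (by simp)) (P t)).hasFDerivAt.comp_hasDerivAt t (hPd t)
  have hq : ∀ t, HasDerivAt (fun t => -((1 - 2 * t) * ‖f (P t)‖ ^ 2))
      (2 * ‖f (P t)‖ ^ 2 - (1 - 2 * t) * (2 * ⟪f (P t), fderiv ℝ f (P t) (c - y)⟫)) t := by
    intro t
    have h1 : HasDerivAt (fun t : ℝ => 1 - 2 * t) (-(2 * 1)) t :=
      ((hasDerivAt_id t).const_mul 2).const_sub 1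
    refine (h1.mul (hfd t).norm_sq).neg.congr_deriv ?_
    ring
  have hint := intervalIntegral.integral_eq_sub_of_hasDerivAt (a := 0) (b := 1 / 2)
    (fun t _ => hq t) (by apply Continuous.intervalIntegrable; fun_prop)
  have h0 : P 0 = y := by simp [hP]
  have h1 : ‖f y‖ ^ 2 = -((1 - 2 * (1 / 2 : ℝ)) * ‖f (P (1 / 2))‖ ^ 2)
      - -((1 - 2 * 0) * ‖f (P 0)‖ ^ 2) := by rw [h0]; ring
  rw [h1, ← hint]
  apply intervalIntegral.integral_mono_on (by norm_num)
  · apply Continuous.intervalIntegrable; fun_prop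
  · apply Continuous.intervalIntegrable; fun_prop
  intro t ht
  have h2 := abs_real_inner_le_norm (f (P t)) (fderiv ℝ f (P t) (c - y))
  have h3 : -(⟪f (P t), fderiv ℝ f (P t) (c - y)⟫ : ℝ)
      ≤ ‖f (P t)‖ * ‖fderiv ℝ f (P t) (c - y)‖ := (neg_le_abs _).trans h2
  have h4 := mul_le_mul_of_nonneg_left h3 (show 0 ≤ 1 - 2 * t by linarith [ht.2])
  have h5 : 0 ≤ 2 * t * (‖f (P t)‖ * ‖fderiv ℝ f (P t) (c - y)‖) := by
    have := ht.1
    positivity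
  nlinarith [sq_nonneg (‖f (P t)‖ - ‖fderiv ℝ f (P t) (c - y)‖)]

theorem enorm_sq_eq_ofReal (x : E) : ‖x‖ₑ ^ 2 = ENNReal.ofReal (‖x‖ ^ 2) := by
  rw [ENNReal.ofReal_pow (norm_nonneg _), ofReal_norm]

theorem enorm_sq_le_lintegral_segment {f : E → E} (hf : ContDiff ℝ (⊤ : ℕ∞) f) {y c : E} {R : ℝ}
    (hR : ‖c - y‖ ≤ R) :
    ‖f y‖ₑ ^ 2 ≤ ∫⁻ t in Ioo (0 : ℝ) (1 / 2), (3 * ‖f ((1 - t) • y + t • c)‖ₑ ^ 2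
      + ENNReal.ofReal (R ^ 2) * ∑ j, ‖fderiv ℝ f ((1 - t) • y + t • c) (e j)‖ₑ ^ 2) := by
  have hdf : Continuous fun x => fderiv ℝ f x := hf.continuous_fderiv (by simp)
  have hfc := hf.continuous
  rw [enorm_sq_eq_ofReal]
  refine (ENNReal.ofReal_le_ofReal (norm_sq_le_integral_segment hf y c)).trans ?_
  rw [intervalIntegral.integral_of_le (by norm_num), integral_Ioc_eq_integral_Ioo,
    ofReal_integral_eq_lintegral_ofReal]
  · refine lintegral_mono fun t => ?_
    have hle := norm_clm_sq_le (fderiv ℝ f ((1 - t) • y + t • c)) (c - y)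
    have h3 : (3 : ℝ≥0∞) = ENNReal.ofReal 3 := by simp
    simp only [enorm_sq_eq_ofReal, h3]
    rw [← ENNReal.ofReal_sum_of_nonneg (fun _ _ => by positivity),
      ← ENNReal.ofReal_mul (by positivity),
      ← ENNReal.ofReal_mul (by positivity), ← ENNReal.ofReal_add (by positivity) (by positivity)]
    apply ENNReal.ofReal_le_ofReal
    gcongr
    refine hle.trans ?_
    gcongr
  · apply IntegrableOn.mono_set _ Ioo_subset_Icc_self
    apply ContinuousOn.integrableOn_Icc
    fun_prop
  · exact Filter.Eventually.of_forall fun t => by positivity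

/-- The trace inequality for smooth fields on a convex body `P` and a bounded flat part `F` of its
boundary. -/
theorem exists_trace_inequality {P F : Set E} (hP : Convex ℝ P) (hPm : MeasurableSet P)
    (s : Submodule ℝ E) (hs : Module.finrank ℝ s = 2) {p c : E} (hc : c - p ∉ s) (hcP : c ∈ P)
    (hFP : F ⊆ P) (hFm : MeasurableSet F) (hF : ∀ y ∈ F, y - p ∈ s) (hFb : Bornology.IsBounded F) :
    ∃ A : ℝ≥0∞, A ≠ ∞ ∧ ∀ f : E → E, ContDiff ℝ (⊤ : ℕ∞) f →
      ∫⁻ y in F, ‖f y‖ₑ ^ 2 ∂μHE[2] ≤ A * ((∫⁻ x in P, ‖f x‖ₑ ^ 2)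
        + ∑ j, ∫⁻ x in P, ‖fderiv ℝ f x (e j)‖ₑ ^ 2) := by
  obtain ⟨A, hA, hcone⟩ := lintegral_cone_le s hs p c hc
  obtain ⟨R, hR⟩ := hFb.subset_closedBall c
  refine ⟨A * (3 + ENNReal.ofReal (R ^ 2)), ENNReal.mul_ne_top hA (by simp), fun f hf => ?_⟩
  have hdf : Continuous fun x => fderiv ℝ f x := hf.continuous_fderiv (by simp)
  have hfc := hf.continuous
  set G : E → ℝ≥0∞ := fun x => 3 * ‖f x‖ₑ ^ 2
    + ENNReal.ofReal (R ^ 2) * ∑ j, ‖fderiv ℝ f x (e j)‖ₑ ^ 2 with hG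
  have hGm : Measurable G := by
    have : Continuous fun x => ∑ j, ‖fderiv ℝ f x (e j)‖ₑ ^ 2 := by fun_prop
    have h2 : Measurable fun x => ‖f x‖ₑ ^ 2 := by fun_prop
    exact (h2.const_mul _).add (this.measurable.const_mul _)
  have hFr : F ⊆ range (fun z : s => (z : E) + p) := fun y hy => ⟨⟨y - p, hF y hy⟩, by simp⟩
  calc ∫⁻ y in F, ‖f y‖ₑ ^ 2 ∂μHE[2]
      ≤ ∫⁻ y in F, (∫⁻ t in Ioo (0 : ℝ) (1 / 2), P.indicator G ((1 - t) • y + t • c)) ∂μHE[2] := by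
        refine setLIntegral_mono' hFm fun y hy => ?_
        have hRy : ‖c - y‖ ≤ R := by
          have := hR hy
          rwa [Metric.mem_closedBall, dist_comm, dist_eq_norm] at this
        refine (enorm_sq_le_lintegral_segment hf hRy).trans ?_
        refine setLIntegral_mono' measurableSet_Ioo fun t ht => ?_
        rw [indicator_of_mem]
        exact hP (hFP hy) hcP (by linarith [ht.2]) ht.1.le (by ring)
    _ ≤ _ := lintegral_mono_set hFr
    _ ≤ A * ∫⁻ x, P.indicator G x := hcone _ (hGm.indicator hPm)
    _ = A * (3 * (∫⁻ x in P, ‖f x‖ₑ ^ 2)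
        + ENNReal.ofReal (R ^ 2) * ∑ j, ∫⁻ x in P, ‖fderiv ℝ f x (e j)‖ₑ ^ 2) := by
        rw [lintegral_indicator hPm, lintegral_add_left (by fun_prop),
          lintegral_const_mul' _ _ (by simp), lintegral_const_mul' _ _ (by simp),
          lintegral_finsetSum _ (fun j _ => by fun_prop)]
    _ ≤ _ := by
        rw [mul_assoc]
        refine mul_le_mul' le_rfl ?_
        rw [mul_add]
        exact add_le_add (mul_le_mul' le_self_add le_rfl) (mul_le_mul' le_add_self le_rfl)

/-- The `i`-th coordinate. -/
def coord (i : Fin 3) : E →ᵃ[ℝ] ℝ := (EuclideanSpace.proj i : E →L[ℝ] ℝ).toLinearMap.toAffineMap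

@[simp] theorem coord_apply (i : Fin 3) (x : E) : coord i x = x i := rfl

/-- The affine function that vanishes on a face of a reference element and is nonnegative on the
element. -/
def RefFace.height : {k : CellKind} → RefFace k → E →ᵃ[ℝ] ℝ
  | _, .hex j s => AffineMap.const ℝ E 1 - s.sign • coord j
  | _, .tet j => ![AffineMap.const ℝ E 1 - coord 0 - coord 1 - coord 2, coord 0, coord 1, coord 2] j
  | _, .wedgeTri s => AffineMap.const ℝ E 1 - s.sign • coord 2
  | _, .wedgeQuad j => ![AffineMap.const ℝ E 1 - coord 0 - coord 1, coord 0, coord 1] j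

theorem height_hex (j : Fin 3) (s : Side) (x : E) :
    (RefFace.hex j s).height x = 1 - s.sign * x j := by
  simp [RefFace.height]

theorem height_tet (j : Fin 4) (x : E) : (RefFace.tet j).height x = tetBary j x := by
  fin_cases j <;> simp [RefFace.height, tetBary]

theorem height_wedgeTri (s : Side) (x : E) :
    (RefFace.wedgeTri s).height x = 1 - s.sign * x 2 := by
  simp [RefFace.height]

theorem height_wedgeQuad (j : Fin 3) (x : E) : (RefFace.wedgeQuad j).height x = triBary j x := by
  fin_cases j <;> simp [RefFace.height, triBary]

theorem abs_le_one_iff_sign (t : ℝ) : |t| ≤ 1 ↔ ∀ s : Side, 0 ≤ 1 - s.sign * t := by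
  rw [abs_le]
  constructor
  · rintro ⟨h1, h2⟩ (_ | _) <;> simp only [Side.sign] <;> linarith
  · intro h
    have h1 := h .minus
    have h2 := h .plus
    simp only [Side.sign] at h1 h2
    constructor <;> linarith

theorem mem_refCell_iff {k : CellKind} {x : E} :
    x ∈ refCell k ↔ ∀ f : RefFace k, 0 ≤ f.height x := by
  cases k
  · simp only [refCell, mem_ofPred_eq, abs_le_one_iff_sign]
    constructor
    · rintro h ⟨j, s⟩
      rw [height_hex]
      exact h j s
    · intro h j s
      have := h (.hex j s)
      rwa [height_hex] at this
  · simp only [refCell, mem_ofPred_eq]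
    constructor
    · intro h f
      cases f with
      | tet j =>
        rw [height_tet]
        exact h j
    · intro h j
      have := h (.tet j)
      rwa [height_tet] at this
  · simp only [refCell, mem_ofPred_eq, abs_le_one_iff_sign]
    constructor
    · rintro ⟨h1, h2⟩ f
      cases f with
      | wedgeTri s =>
        rw [height_wedgeTri]
        exact h2 s
      | wedgeQuad j =>
        rw [height_wedgeQuad]
        exact h1 j
    · refine fun h => ⟨fun j => ?_, fun s => ?_⟩
      · have := h (.wedgeQuad j)
        rwa [height_wedgeQuad] at this
      · have := h (.wedgeTri s)
        rwa [height_wedgeTri] at this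

theorem eq_sign_iff (s : Side) (t : ℝ) : t = s.sign ↔ 1 - s.sign * t = 0 := by
  cases s <;> simp only [Side.sign] <;> constructor <;> intro h <;> linarith

theorem mem_toSet_iff {k : CellKind} {f : RefFace k} {x : E} :
    x ∈ f.toSet ↔ x ∈ refCell k ∧ f.height x = 0 := by
  cases f
  · rw [height_hex, ← eq_sign_iff]
    rfl
  · rw [height_tet]
    rfl
  · rw [height_wedgeTri, ← eq_sign_iff]
    rfl
  · rw [height_wedgeQuad]
    rfl

instance : Finite Side :=
  Finite.of_surjective (fun b : Bool => if b then Side.plus else Side.minus) fun s => by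
    cases s
    · exact ⟨false, rfl⟩
    · exact ⟨true, rfl⟩

instance (k : CellKind) : Finite (RefFace k) := by
  cases k
  · refine Finite.of_surjective (fun p : Fin 3 × Side => RefFace.hex p.1 p.2) ?_
    rintro ⟨j, s⟩
    exact ⟨(j, s), rfl⟩
  · refine Finite.of_surjective (fun j : Fin 4 => RefFace.tet j) ?_
    intro f
    cases f with
    | tet j => exact ⟨j, rfl⟩
  · refine Finite.of_surjective (fun p : Side ⊕ Fin 3 =>
      p.elim (fun s => RefFace.wedgeTri s) (fun j => RefFace.wedgeQuad j)) ?_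
    intro f
    cases f with
    | wedgeTri s => exact ⟨.inl s, rfl⟩
    | wedgeQuad j => exact ⟨.inr j, rfl⟩

/-- Every face has a relatively interior point. -/
theorem RefFace.exists_interior {k : CellKind} (f : RefFace k) :
    ∃ x : E, f.height x = 0 ∧ ∀ f', f' ≠ f → 0 < f'.height x := by
  cases f with
  | hex j s =>
    refine ⟨s.sign • e j, ?_, ?_⟩
    · rw [height_hex]
      cases s <;> simp [e, Side.sign]
    · rintro ⟨j', s'⟩ hne
      rw [height_hex]
      by_cases hj : j' = j
      · subst hj
        cases s <;> cases s' <;> simp [e, Side.sign] at hne ⊢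
      · simp [e, hj]
  | tet j =>
    refine ⟨!₂[if j = 1 then 0 else 1 / 3, if j = 2 then 0 else 1 / 3,
      if j = 3 then 0 else 1 / 3], ?_, ?_⟩
    · rw [height_tet]
      fin_cases j <;> simp [tetBary] <;> norm_num
    · intro f hne
      cases f with | tet j' => ?_
      rw [height_tet]
      fin_cases j <;> fin_cases j' <;> simp [tetBary] at hne ⊢ <;> norm_num
  | wedgeTri s =>
    refine ⟨!₂[1 / 3, 1 / 3, s.sign], ?_, ?_⟩
    · rw [height_wedgeTri]
      cases s <;> simp [Side.sign]
    · intro f hne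
      cases f with
      | wedgeTri s' =>
        rw [height_wedgeTri]
        cases s <;> cases s' <;> simp [Side.sign] at hne ⊢
      | wedgeQuad j' =>
        rw [height_wedgeQuad]
        fin_cases j' <;> simp [triBary] <;> norm_num
  | wedgeQuad j =>
    refine ⟨!₂[if j = 1 then 0 else 1 / 2, if j = 2 then 0 else 1 / 2, 0], ?_, ?_⟩
    · rw [height_wedgeQuad]
      fin_cases j <;> simp [triBary] <;> norm_num
    · intro f hne
      cases f with
      | wedgeTri s' =>
        rw [height_wedgeTri]
        simp
      | wedgeQuad j' =>
        rw [height_wedgeQuad]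
        fin_cases j <;> fin_cases j' <;> simp [triBary] at hne ⊢ <;> norm_num

theorem exists_interior_refCell (k : CellKind) : ∃ x : E, ∀ f : RefFace k, 0 < f.height x := by
  cases k
  · refine ⟨0, ?_⟩
    rintro ⟨j, s⟩
    simp [height_hex]
  · refine ⟨!₂[1 / 4, 1 / 4, 1 / 4], ?_⟩
    intro f
    cases f with | tet j => ?_
    rw [height_tet]
    fin_cases j <;> simp [tetBary] <;> norm_num
  · refine ⟨!₂[1 / 3, 1 / 3, 0], ?_⟩
    intro f
    cases f with
    | wedgeTri s => simp [height_wedgeTri]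
    | wedgeQuad j =>
      rw [height_wedgeQuad]
      fin_cases j <;> simp [triBary] <;> norm_num

theorem isBounded_refCell (k : CellKind) : Bornology.IsBounded (refCell k) := by
  refine (Metric.isBounded_closedBall (x := (0 : E)) (r := 2)).subset fun x hx => ?_
  have h : ∀ i, |x i| ≤ 1 := by
    cases k
    · exact hx
    · have h0 := hx 0
      have h1 := hx 1
      have h2 := hx 2
      have h3 := hx 3
      simp [tetBary] at h0 h1 h2 h3
      intro i
      rw [abs_le]
      fin_cases i <;> constructor <;> simp <;> linarith
    · have h0 := hx.1 0
      have h1 := hx.1 1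
      have h2 := hx.1 2
      have h3 := abs_le.1 hx.2
      simp [triBary] at h0 h1 h2
      intro i
      rw [abs_le]
      fin_cases i <;> constructor <;> simp <;> linarith
  rw [mem_closedBall_zero_iff, EuclideanSpace.norm_eq, Real.sqrt_le_left (by norm_num)]
  calc ∑ i, ‖x i‖ ^ 2 ≤ ∑ i : Fin 3, (1 : ℝ) := by
        refine Finset.sum_le_sum fun i _ => ?_
        have := h i
        rw [Real.norm_eq_abs]
        nlinarith [abs_nonneg (x i)]
    _ ≤ 2 ^ 2 := by norm_num

namespace FaultMesh

variable {ι κ : Type*} (T : FaultMesh ι κ)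

/-- The affine function that vanishes on a face of an element and is nonnegative on the element. -/
def height (K : ι) (f : RefFace (T.kind K)) : E →ᵃ[ℝ] ℝ :=
  f.height.comp (T.map K).symm.toAffineMap

theorem height_apply (K : ι) (f : RefFace (T.kind K)) (x : E) :
    T.height K f x = f.height ((T.map K).symm x) := rfl

theorem mem_cell_iff {K : ι} {x : E} : x ∈ T.cell K ↔ ∀ f, 0 ≤ T.height K f x := by
  simp only [height_apply, ← mem_refCell_iff, cell]
  constructor
  · rintro ⟨y, hy, rfl⟩
    simpa using hy
  · exact fun h => ⟨_, h, by simp⟩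

theorem mem_cellFace_iff {K : ι} {f : RefFace (T.kind K)} {x : E} :
    x ∈ T.cellFace K f ↔ x ∈ T.cell K ∧ T.height K f x = 0 := by
  rw [mem_cell_iff]
  simp only [height_apply, ← mem_refCell_iff, cellFace, ← mem_toSet_iff]
  constructor
  · rintro ⟨y, hy, rfl⟩
    simpa using hy
  · exact fun h => ⟨_, h, by simp⟩

theorem cellFace_subset (K : ι) (f : RefFace (T.kind K)) : T.cellFace K f ⊆ T.cell K :=
  fun _ hx => (T.mem_cellFace_iff.1 hx).1

theorem continuous_height (K : ι) (f : RefFace (T.kind K)) : Continuous (T.height K f) :=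
  AffineMap.continuous_of_finiteDimensional _

theorem exists_cellFace_interior (K : ι) (f : RefFace (T.kind K)) :
    ∃ x, T.height K f x = 0 ∧ ∀ f', f' ≠ f → 0 < T.height K f' x := by
  obtain ⟨x, h1, h2⟩ := f.exists_interior
  exact ⟨T.map K x, by simpa [height_apply] using h1, by simpa [height_apply] using h2⟩

theorem exists_cell_interior (K : ι) : ∃ x, ∀ f, 0 < T.height K f x := by
  obtain ⟨x, h⟩ := exists_interior_refCell (T.kind K)
  exact ⟨T.map K x, by simpa [height_apply] using h⟩

theorem isClosed_cell (K : ι) : IsClosed (T.cell K) := by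
  have : T.cell K = ⋂ f, {x | 0 ≤ T.height K f x} := by
    ext x
    simp [mem_cell_iff]
  rw [this]
  exact isClosed_iInter fun f => isClosed_le continuous_const (T.continuous_height K f)

theorem isClosed_cellFace (K : ι) (f : RefFace (T.kind K)) : IsClosed (T.cellFace K f) := by
  have : T.cellFace K f = T.cell K ∩ {x | T.height K f x = 0} := by
    ext x
    simp [mem_cellFace_iff]
  rw [this]
  exact (T.isClosed_cell K).inter (isClosed_eq (T.continuous_height K f) continuous_const)

theorem height_convex_comb (K : ι) (f : RefFace (T.kind K)) (x y : E) {a b : ℝ} (h : a + b = 1) :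
    T.height K f (a • x + b • y) = a * T.height K f x + b * T.height K f y := by
  have hb : b = 1 - a := by linarith
  subst hb
  have hx : a • x + (1 - a) • y = AffineMap.lineMap y x a := by
    rw [AffineMap.lineMap_apply_module]
    abel
  rw [hx, AffineMap.apply_lineMap, AffineMap.lineMap_apply_module]
  simp only [smul_eq_mul]
  ring

theorem convex_cell (K : ι) : Convex ℝ (T.cell K) := by
  intro x hx y hy a b ha hb hab
  rw [mem_cell_iff] at *
  intro f
  rw [height_convex_comb _ _ _ _ _ hab]
  have := hx f
  have := hy f
  positivity

theorem isBounded_cell (K : ι) : Bornology.IsBounded (T.cell K) := by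
  have hc : IsCompact (closure (refCell (T.kind K))) := (isBounded_refCell _).isCompact_closure
  have := (hc.image (AffineMap.continuous_of_finiteDimensional (T.map K).toAffineMap)).isBounded
  exact this.subset (image_mono subset_closure)

theorem isCompact_cell (K : ι) : IsCompact (T.cell K) :=
  Metric.isCompact_of_isClosed_isBounded (T.isClosed_cell K) (T.isBounded_cell K)

theorem isOpen_setOf_height_pos (K : ι) (p : RefFace (T.kind K) → Prop) :
    IsOpen {x | ∀ f, p f → 0 < T.height K f x} := by
  have : {x | ∀ f, p f → 0 < T.height K f x}
      = ⋂ f, {x | p f → 0 < T.height K f x} := by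
    ext x
    simp
  rw [this]
  refine isOpen_iInter_of_finite fun f => ?_
  by_cases h : p f
  · simpa [h] using isOpen_lt continuous_const (T.continuous_height K f)
  · simp [h]

theorem mem_interior_cell {K : ι} {x : E} (h : ∀ f, 0 < T.height K f x) :
    x ∈ interior (T.cell K) := by
  refine mem_interior.2 ⟨{x | ∀ f, True → 0 < T.height K f x}, fun y hy => ?_,
    T.isOpen_setOf_height_pos K _, fun f _ => h f⟩
  exact T.mem_cell_iff.2 fun f => (hy f trivial).le

theorem volume_frontier_cell (K : ι) : volume (frontier (T.cell K)) = 0 :=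
  (T.convex_cell K).addHaar_frontier volume

theorem volume_cellFace (K : ι) (f : RefFace (T.kind K)) : volume (T.cellFace K f) = 0 := by
  refine measure_mono_null (fun x hx => ?_) (T.volume_frontier_cell K)
  refine ⟨subset_closure (T.cellFace_subset K f hx), fun hi => ?_⟩
  obtain ⟨c, hc⟩ := T.exists_cell_interior K
  have hlim : Filter.Tendsto (fun t : ℝ => (1 + t) • x + (-t) • c) (nhds 0) (nhds x) := by
    have : Continuous fun t : ℝ => (1 + t) • x + (-t) • c := by fun_prop
    simpa using this.tendsto 0
  have h1 := (hlim.eventually (mem_interior_iff_mem_nhds.1 hi)).filter_mono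
    (nhdsWithin_le_nhds (s := Ioi 0))
  obtain ⟨t, ht, ht0⟩ := (h1.and self_mem_nhdsWithin).exists
  have h2 := (T.mem_cell_iff.1 ht) f
  rw [height_convex_comb _ _ _ _ _ (by ring), (T.mem_cellFace_iff.1 hx).2] at h2
  nlinarith [hc f, ht0]

theorem face_eq_cellFace (s : Side) (φ : κ) :
    T.face φ = T.cellFace (T.side s φ) (T.sideFace s φ) := by
  cases s
  · exact (T.face_eq φ).symm
  · rfl

theorem measurableSet_cell (K : ι) : MeasurableSet (T.cell K) := (T.isClosed_cell K).measurableSet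

theorem measurableSet_cellFace (K : ι) (f : RefFace (T.kind K)) :
    MeasurableSet (T.cellFace K f) := (T.isClosed_cellFace K f).measurableSet

theorem isClosed_face (φ : κ) : IsClosed (T.face φ) := by
  rw [T.face_eq_cellFace .plus]
  exact T.isClosed_cellFace _ _

theorem isOpen_Ω : IsOpen T.Ω := by
  rw [← T.interior_closure]
  exact isOpen_interior

theorem cell_subset_closure (K : ι) : T.cell K ⊆ closure T.Ω := by
  rw [T.closure_eq]
  exact subset_iUnion (fun K => T.map K '' refCell (T.kind K)) K

theorem interior_cell_subset (K : ι) : interior (T.cell K) ⊆ T.Ω := by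
  rw [← T.interior_closure]
  exact interior_mono (T.cell_subset_closure K)

theorem volume_Γf [Countable κ] : volume T.Γf = 0 :=
  measure_iUnion_null fun φ => by
    rw [T.face_eq_cellFace .plus]
    exact T.volume_cellFace _ _

theorem restrict_O_cell [Countable κ] (K : ι) :
    ((volume : Measure E).restrict T.O).restrict (T.cell K) = volume.restrict (T.cell K) := by
  rw [Measure.restrict_restrict (T.measurableSet_cell K)]
  refine Measure.restrict_congr_set ?_
  refine (inter_subset_left.eventuallyLE).antisymm ?_
  rw [ae_le_set]
  refine measure_mono_null (t := frontier (T.cell K) ∪ T.Γf) ?_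
    (measure_union_null (T.volume_frontier_cell K) T.volume_Γf)
  rintro x ⟨h1, h2⟩
  by_contra hx
  simp only [mem_union, not_or, (T.isClosed_cell _).frontier_eq, mem_sdiff, not_and, not_not] at hx
  exact h2 ⟨h1, T.interior_cell_subset K (hx.1 h1), hx.2⟩

theorem volume_cell_inter {K K' : ι} (h : K ≠ K') : volume (T.cell K ∩ T.cell K') = 0 := by
  refine measure_mono_null (t := frontier (T.cell K) ∪ frontier (T.cell K')) ?_
    (measure_union_null (T.volume_frontier_cell K) (T.volume_frontier_cell K'))
  rintro x ⟨h1, h2⟩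
  by_contra hx
  simp only [mem_union, not_or, (T.isClosed_cell _).frontier_eq, mem_sdiff, not_and, not_not] at hx
  exact (T.nonoverlapping K K' h).le_bot ⟨hx.1 h1, hx.2 h2⟩

end FaultMesh

theorem ofReal_norm_sq_eq_lintegral {μ : Measure E} (u : Lp E 2 μ) :
    ENNReal.ofReal (‖u‖ ^ 2) = ∫⁻ x, ‖u x‖ₑ ^ 2 ∂μ := by
  have h := eLpNorm_nnreal_pow_eq_lintegral (f := (u : E → E)) (p := 2) (μ := μ) (by simp)
  rw [ENNReal.ofReal_pow (norm_nonneg _), ofReal_norm, Lp.enorm_def]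
  simpa using h

namespace FaultMesh

variable {ι κ : Type*} (T : FaultMesh ι κ)

theorem linear_height_sub {K : ι} {f : RefFace (T.kind K)} {p : E} (hp : T.height K f p = 0)
    (x : E) : (T.height K f).linear (x - p) = T.height K f x := by
  simpa [hp] using (T.height K f).linearMap_vsub x p

theorem finrank_ker_height (K : ι) (f : RefFace (T.kind K)) :
    Module.finrank ℝ (LinearMap.ker (T.height K f).linear) = 2 := by
  obtain ⟨c, hc⟩ := T.exists_cell_interior K
  obtain ⟨p, hp, -⟩ := T.exists_cellFace_interior K f
  have h0 : (T.height K f).linear ≠ 0 := by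
    intro h
    have := T.linear_height_sub hp c
    rw [h] at this
    exact (hc f).ne this
  have := Module.Dual.finrank_ker_add_one_of_ne_zero (f := (T.height K f).linear) h0
  have h3 : Module.finrank ℝ E = 3 := by simp
  omega

theorem exists_smooth_trace_inequality (K : ι) (f : RefFace (T.kind K)) :
    ∃ A : ℝ≥0∞, A ≠ ∞ ∧ ∀ v : E → E, ContDiff ℝ (⊤ : ℕ∞) v →
      ∫⁻ y in T.cellFace K f, ‖v y‖ₑ ^ 2 ∂μHE[2] ≤ A * ((∫⁻ x in T.cell K, ‖v x‖ₑ ^ 2)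
        + ∑ j, ∫⁻ x in T.cell K, ‖fderiv ℝ v x (e j)‖ₑ ^ 2) := by
  obtain ⟨c, hc⟩ := T.exists_cell_interior K
  obtain ⟨p, hp, -⟩ := T.exists_cellFace_interior K f
  refine exists_trace_inequality (T.convex_cell K) (T.measurableSet_cell K) _
    (T.finrank_ker_height K f) (p := p)
    (c := c) ?_ (T.mem_cell_iff.2 fun f => (hc f).le) (T.cellFace_subset K f)
    (T.measurableSet_cellFace K f) ?_ ((T.isBounded_cell K).subset (T.cellFace_subset K f))
  · intro h
    rw [LinearMap.mem_ker, T.linear_height_sub hp] at h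
    exact (hc f).ne' h
  · intro y hy
    rw [LinearMap.mem_ker, T.linear_height_sub hp]
    exact (T.mem_cellFace_iff.1 hy).2

theorem memLp_cell [Countable κ] (K : ι) {v : E → E} (hv : Continuous v) :
    MemLp v 2 ((volume.restrict T.O).restrict (T.cell K)) := by
  rw [T.restrict_O_cell]
  have : IsFiniteMeasure ((volume : Measure E).restrict (T.cell K)) :=
    ⟨by simpa using (T.isCompact_cell K).measure_lt_top⟩
  obtain ⟨C, hC⟩ := (T.isCompact_cell K).exists_bound_of_continuousOn hv.continuousOn
  refine MemLp.of_bound hv.aestronglyMeasurable C ?_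
  exact (ae_restrict_iff' (T.measurableSet_cell K)).2 (Filter.Eventually.of_forall hC)

theorem lintegral_cell_lt_top (K : ι) {v : E → E} (hv : Continuous v) :
    ∫⁻ x in T.cell K, ‖v x‖ₑ ^ 2 < ∞ := by
  obtain ⟨C, hC⟩ := (T.isCompact_cell K).exists_bound_of_continuousOn hv.continuousOn
  refine (setLIntegral_mono' (T.measurableSet_cell K) (g := fun _ => ENNReal.ofReal (C ^ 2))
    fun x hx => ?_).trans_lt ?_
  · rw [enorm_sq_eq_ofReal]
    apply ENNReal.ofReal_le_ofReal
    have := hC x hx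
    gcongr
  · rw [setLIntegral_const]
    exact ENNReal.mul_lt_top (by simp) (T.isCompact_cell K).measure_lt_top

/-- Smooth fields are square integrable on the faces of the elements. -/
theorem memLp_cellFace (K : ι) (f : RefFace (T.kind K)) {v : E → E}
    (hv : ContDiff ℝ (⊤ : ℕ∞) v) : MemLp v 2 (μHE[2].restrict (T.cellFace K f)) := by
  refine ⟨hv.continuous.aestronglyMeasurable, ?_⟩
  obtain ⟨A, hA, hle⟩ := T.exists_smooth_trace_inequality K f
  have hdf : Continuous fun x => fderiv ℝ v x := hv.continuous_fderiv (by simp)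
  have h := (hle v hv).trans_lt (ENNReal.mul_lt_top hA.lt_top (ENNReal.add_lt_top.2
    ⟨T.lintegral_cell_lt_top K hv.continuous, ENNReal.sum_lt_top.2 fun j _ =>
      T.lintegral_cell_lt_top K (by fun_prop)⟩))
  have h2 := eLpNorm_nnreal_pow_eq_lintegral (f := v) (p := 2)
    (μ := μHE[2].restrict (T.cellFace K f)) (by simp)
  have h3 : eLpNorm v 2 (μHE[2].restrict (T.cellFace K f)) ^ 2 < ∞ := by
    refine lt_of_eq_of_lt ?_ h
    simpa using h2
  exact (ENNReal.pow_lt_top_iff.1 h3).resolve_right (by norm_num)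

/-- The trace inequality. -/
theorem exists_trace_bound [Countable κ] (K : ι) (f : RefFace (T.kind K)) :
    ∃ A : ℝ, 0 ≤ A ∧ ∀ q ∈ (smoothTraceGraph T.O (T.cell K) (T.cellFace K f)).topologicalClosure,
      ‖q.2.2‖ ^ 2 ≤ A * (‖q.1‖ ^ 2 + ∑ j, ‖q.2.1 j‖ ^ 2) := by
  obtain ⟨A, hA, hle⟩ := T.exists_smooth_trace_inequality K f
  refine ⟨A.toReal, ENNReal.toReal_nonneg, fun q hq => ?_⟩
  have hcl : IsClosed {q : L2On T.O (T.cell K) × (Fin 3 → L2On T.O (T.cell K)) ×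
      L2Surf (T.cellFace K f) | ‖q.2.2‖ ^ 2 ≤ A.toReal * (‖q.1‖ ^ 2 + ∑ j, ‖q.2.1 j‖ ^ 2)} :=
    isClosed_le (by fun_prop) (by fun_prop)
  refine closure_minimal ?_ hcl hq
  rintro ⟨u, du, g⟩ ⟨v, hv, h1, h2, h3⟩
  have key := hle v hv
  have e1 : ENNReal.ofReal (‖u‖ ^ 2) = ∫⁻ x in T.cell K, ‖v x‖ₑ ^ 2 := by
    rw [ofReal_norm_sq_eq_lintegral, ← T.restrict_O_cell]
    exact lintegral_congr_ae (h1.mono fun x hx => by simp only at hx; simp only [hx])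
  have e2 : ∀ j, ENNReal.ofReal (‖du j‖ ^ 2) = ∫⁻ x in T.cell K, ‖fderiv ℝ v x (e j)‖ₑ ^ 2 := by
    intro j
    rw [ofReal_norm_sq_eq_lintegral, ← T.restrict_O_cell]
    exact lintegral_congr_ae ((h2 j).mono fun x hx => by simp only at hx; simp only [hx])
  have e3 : ENNReal.ofReal (‖g‖ ^ 2) = ∫⁻ y in T.cellFace K f, ‖v y‖ₑ ^ 2 ∂μHE[2] := by
    rw [ofReal_norm_sq_eq_lintegral]
    exact lintegral_congr_ae (h3.mono fun x hx => by simp only at hx; simp only [hx])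
  simp only [← e1, ← e2, ← e3] at key
  rw [← ENNReal.ofReal_sum_of_nonneg (fun _ _ => by positivity),
    ← ENNReal.ofReal_add (by positivity) (Finset.sum_nonneg fun _ _ => by positivity),
    ← ENNReal.ofReal_toReal hA, ← ENNReal.ofReal_mul ENNReal.toReal_nonneg] at key
  refine (ENNReal.ofReal_le_ofReal_iff ?_).1 key
  have := Finset.sum_nonneg fun j (_ : j ∈ Finset.univ) => sq_nonneg ‖du j‖
  positivity

theorem isTrace_unique [Countable κ] {K : ι} {f : RefFace (T.kind K)} {w : Pair T.O}
    {g g' : L2Surf (T.cellFace K f)} (h : IsTrace (T.cell K) (T.cellFace K f) w g)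
    (h' : IsTrace (T.cell K) (T.cellFace K f) w g') : g = g' := by
  obtain ⟨A, -, hA⟩ := T.exists_trace_bound K f
  have := hA _ (sub_mem h h')
  simp only [Prod.snd_sub, Prod.fst_sub, sub_self, norm_zero, Pi.zero_apply] at this
  have h0 : ‖g - g'‖ ^ 2 ≤ 0 := by simpa using this
  have h1 : ‖g - g'‖ = 0 := by nlinarith [norm_nonneg (g - g')]
  exact sub_eq_zero.1 (norm_eq_zero.1 h1)

theorem sideTrace_eq [Countable κ] {s : Side} {φ : κ} {w : Pair T.O} {g : L2Surf (T.face φ)}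
    (h : IsTrace (T.cell (T.side s φ)) (T.face φ) w g) : T.sideTrace s φ w = g := by
  have hex : ∃ g, IsTrace (T.cell (T.side s φ)) (T.face φ) w g := ⟨g, h⟩
  have hdef : T.sideTrace s φ w = hex.choose := by
    simp only [sideTrace, trace, dif_pos hex]
  rw [hdef]
  have hch := hex.choose_spec
  generalize hex.choose = g' at hch
  clear hdef hex
  revert g g'
  rw [T.face_eq_cellFace s φ]
  intro g h g' h'
  exact T.isTrace_unique h' h

theorem isTrace_sideTrace {w : Pair T.O} (hw : w ∈ T.U) (s : Side) (φ : κ) :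
    IsTrace (T.cell (T.side s φ)) (T.face φ) w (T.sideTrace s φ w) := by
  have hex : ∃ g, IsTrace (T.cell (T.side s φ)) (T.face φ) w g := by
    rw [T.face_eq_cellFace s φ]
    obtain ⟨g, hg, -⟩ := hw.2 (T.side s φ) (T.sideFace s φ)
    exact ⟨g, hg⟩
  simp only [sideTrace, trace, dif_pos hex]
  exact hex.choose_spec

theorem sideTrace_sub [Countable κ] {w w' : Pair T.O} (hw : w ∈ T.U) (hw' : w' ∈ T.U) (s : Side)
    (φ : κ) : T.sideTrace s φ (w - w') = T.sideTrace s φ w - T.sideTrace s φ w' := by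
  refine T.sideTrace_eq ?_
  have h := (T.isTrace_sideTrace hw s φ).add ((T.isTrace_sideTrace hw' s φ).smul (-1))
  simpa [sub_eq_add_neg] using h

theorem exists_sideTrace_bound [Countable κ] (s : Side) (φ : κ) :
    ∃ A : ℝ, 0 ≤ A ∧ ∀ w ∈ T.U,
      ‖T.sideTrace s φ w‖ ^ 2 ≤ A * (‖w.1‖ ^ 2 + ∑ j, ‖w.2 j‖ ^ 2) := by
  have hb := T.exists_trace_bound (T.side s φ) (T.sideFace s φ)
  rw [← T.face_eq_cellFace s φ] at hb
  obtain ⟨A, hA, hle⟩ := hb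
  refine ⟨A, hA, fun w hw => (hle _ (T.isTrace_sideTrace hw s φ)).trans ?_⟩
  have hr : ∀ u : L2 T.O, ‖restr T.O (T.cell (T.side s φ)) u‖ ≤ ‖u‖ := fun u =>
    norm_Lp_toLp_restrict_le _ u
  have h1 := hr w.1
  have h2 := fun j => hr (w.2 j)
  simp only
  gcongr with j
  exact h2 j

theorem diam_pos [Finite ι] [Nonempty ι] : 0 < Metric.diam T.Ω := by
  obtain ⟨K⟩ := ‹Nonempty ι›
  obtain ⟨c, hc⟩ := T.exists_cell_interior K
  have hcΩ : c ∈ T.Ω := T.interior_cell_subset K (T.mem_interior_cell hc)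
  have hb : Bornology.IsBounded T.Ω := by
    refine Bornology.IsBounded.subset ?_ subset_closure
    rw [T.closure_eq]
    exact Bornology.isBounded_iUnion.2 T.isBounded_cell
  obtain ⟨r, hr, hball⟩ := Metric.isOpen_iff.1 T.isOpen_Ω c hcΩ
  have hd : c + (r / 2) • e 0 ∈ T.Ω := by
    refine hball ?_
    simp [e, norm_smul, abs_of_pos hr, hr]
  have h1 := Metric.dist_le_diam_of_mem hb hd hcΩ
  refine lt_of_lt_of_le ?_ h1
  simp [e, norm_smul, hr.ne']

theorem normU_sq (w : Pair T.O) : T.normU w ^ 2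
    = (Metric.diam T.Ω) ^ (-2 : ℤ) * ‖w.1‖ ^ 2 + ∑ j, ‖w.2 j‖ ^ 2 := by
  rw [normU, Real.sq_sqrt]
  have := Finset.sum_nonneg fun j (_ : j ∈ Finset.univ) => sq_nonneg ‖w.2 j‖
  have h2 : 0 ≤ (Metric.diam T.Ω) ^ (-2 : ℤ) := zpow_nonneg Metric.diam_nonneg _
  positivity

theorem normU_nonneg (w : Pair T.O) : 0 ≤ T.normU w := Real.sqrt_nonneg _

theorem norm_sq_le_normU_sq [Finite ι] [Nonempty ι] (w : Pair T.O) :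
    ‖w.1‖ ^ 2 + ∑ j, ‖w.2 j‖ ^ 2 ≤ (Metric.diam T.Ω ^ 2 + 1) * T.normU w ^ 2 := by
  have hd := T.diam_pos
  rw [normU_sq]
  have h1 : Metric.diam T.Ω ^ 2 * ((Metric.diam T.Ω) ^ (-2 : ℤ) * ‖w.1‖ ^ 2) = ‖w.1‖ ^ 2 := by
    rw [zpow_neg, ← mul_assoc]
    norm_cast
    rw [mul_inv_cancel₀ (by positivity), one_mul]
  have h2 := Finset.sum_nonneg fun j (_ : j ∈ Finset.univ) => sq_nonneg ‖w.2 j‖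
  have h3 : 0 ≤ (Metric.diam T.Ω) ^ (-2 : ℤ) * ‖w.1‖ ^ 2 := by positivity
  have h4 := mul_nonneg (sq_nonneg (Metric.diam T.Ω)) h2
  nlinarith

/-- The restriction of a traction to a face. -/
def onFace (μ : L2Surf T.Γf) (φ : κ) : L2Surf (T.face φ) :=
  MemLp.toLp μ ((Lp.memLp μ).mono_measure (Measure.restrict_mono (T.face_subset φ) le_rfl))

theorem coeFn_onFace (μ : L2Surf T.Γf) (φ : κ) :
    T.onFace μ φ =ᵐ[μHE[2].restrict (T.face φ)] μ := MemLp.coeFn_toLp _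

theorem b_eq_sum [Fintype κ] (μ : L2Surf T.Γf) (w : Pair T.O) :
    T.b μ w = ∑ φ, ⟪T.onFace μ φ, T.sideTrace .plus φ w - T.sideTrace .minus φ w⟫ := by
  have hr : ∀ φ, (μHE[2].restrict T.Γf : Measure E).restrict (T.face φ)
      = μHE[2].restrict (T.face φ) := fun φ =>
    Measure.restrict_restrict_of_subset (T.face_subset φ)
  have hm : ∀ φ, MeasurableSet (T.face φ) := fun φ => (T.isClosed_face φ).measurableSet
  have hae : ∀ φ, (fun x => ⟪T.onFace μ φ x, (T.sideTrace .plus φ w - T.sideTrace .minus φ w) x⟫)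
      =ᵐ[μHE[2].restrict (T.face φ)]
      fun x => ⟪μ x, T.sideTrace .plus φ w x - T.sideTrace .minus φ w x⟫ := by
    intro φ
    filter_upwards [T.coeFn_onFace μ φ,
      Lp.coeFn_sub (T.sideTrace .plus φ w) (T.sideTrace .minus φ w)] with x h1 h2
    rw [h1, h2, Pi.sub_apply]
  have hrw : ∀ x, ⟪μ x, T.jump w x⟫ = ∑ φ, (T.face φ).indicator
      (fun x => ⟪μ x, T.sideTrace .plus φ w x - T.sideTrace .minus φ w x⟫) x := by
    intro x
    rw [jump, inner_sum]
    refine Finset.sum_congr rfl fun φ _ => ?_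
    by_cases hx : x ∈ T.face φ
    · simp [hx]
    · simp [hx]
  unfold b pairing
  simp only [hrw]
  rw [integral_finsetSum]
  · refine Finset.sum_congr rfl fun φ _ => ?_
    rw [integral_indicator (hm φ), hr, L2.inner_def]
    exact (integral_congr_ae (hae φ)).symm
  · intro φ _
    rw [integrable_indicator_iff (hm φ), IntegrableOn, hr]
    exact (L2.integrable_inner _ _).congr (hae φ)

theorem b_sub [Fintype κ] (μ : L2Surf T.Γf) {w w' : Pair T.O} (hw : w ∈ T.U) (hw' : w' ∈ T.U) :
    T.b μ (w - w') = T.b μ w - T.b μ w' := by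
  simp only [b_eq_sum, T.sideTrace_sub hw hw', ← Finset.sum_sub_distrib, ← inner_sub_right]
  refine Finset.sum_congr rfl fun φ _ => ?_
  congr 1
  abel

theorem memLp_jump [Fintype κ] (w : Pair T.O) : MemLp (T.jump w) 2 (μHE[2].restrict T.Γf) := by
  unfold jump
  refine memLp_finsetSum _ fun φ _ => ?_
  have hm : MeasurableSet (T.face φ) := (T.isClosed_face φ).measurableSet
  rw [memLp_indicator_iff_restrict hm, Measure.restrict_restrict_of_subset (T.face_subset φ)]
  exact (Lp.memLp _).sub (Lp.memLp _)

/-- The form `b` is continuous on the displacement space. -/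
theorem exists_b_bound [Fintype κ] [Finite ι] [Nonempty ι] (μ : L2Surf T.Γf) :
    ∃ B : ℝ, 0 ≤ B ∧ ∀ w ∈ T.U, |T.b μ w| ≤ B * T.normU w := by
  choose A hA0 hA using fun s φ => T.exists_sideTrace_bound s φ
  set D := Metric.diam T.Ω ^ 2 + 1 with hD
  have hD0 : 0 ≤ D := by positivity
  have htr : ∀ s φ, ∀ w ∈ T.U, ‖T.sideTrace s φ w‖ ≤ Real.sqrt (A s φ * D) * T.normU w := by
    intro s φ w hw
    refine le_of_sq_le_sq ?_ (mul_nonneg (Real.sqrt_nonneg _) (T.normU_nonneg w))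
    rw [mul_pow, Real.sq_sqrt (mul_nonneg (hA0 s φ) hD0), mul_assoc]
    exact (hA s φ w hw).trans (mul_le_mul_of_nonneg_left (T.norm_sq_le_normU_sq w) (hA0 s φ))
  refine ⟨∑ φ, ‖T.onFace μ φ‖ * (Real.sqrt (A .plus φ * D) + Real.sqrt (A .minus φ * D)),
    Finset.sum_nonneg fun φ _ => by positivity, fun w hw => ?_⟩
  rw [b_eq_sum, Finset.sum_mul]
  refine (Finset.abs_sum_le_sum_abs _ _).trans (Finset.sum_le_sum fun φ _ => ?_)
  refine (abs_real_inner_le_norm _ _).trans ?_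
  rw [mul_assoc, add_mul]
  refine mul_le_mul_of_nonneg_left ?_ (norm_nonneg _)
  exact (norm_sub_le _ _).trans (add_le_add (htr _ _ w hw) (htr _ _ w hw))

/-- The midpoint of two relatively interior points of a face, seen from its two sides, is
relatively interior for both sides. -/
theorem exists_face_interior (φ : κ) : ∃ x ∈ T.face φ, ∀ s, ∀ f, f ≠ T.sideFace s φ →
    0 < T.height (T.side s φ) f x := by
  choose x h0 hpos using fun s => T.exists_cellFace_interior (T.side s φ) (T.sideFace s φ)
  have hx : ∀ s, x s ∈ T.face φ := by
    intro s
    rw [T.face_eq_cellFace s φ, mem_cellFace_iff, mem_cell_iff]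
    refine ⟨fun f => ?_, h0 s⟩
    by_cases hf : f = T.sideFace s φ
    · rw [hf, h0 s]
    · exact (hpos s f hf).le
  have hmem : ∀ s s', x s' ∈ T.cellFace (T.side s φ) (T.sideFace s φ) := fun s s' => by
    rw [← T.face_eq_cellFace s φ]
    exact hx s'
  have hnn : ∀ s s' f, 0 ≤ T.height (T.side s φ) f (x s') := fun s s' f =>
    T.mem_cell_iff.1 (T.cellFace_subset _ _ (hmem s s')) f
  refine ⟨(1 / 2 : ℝ) • x .minus + (1 / 2 : ℝ) • x .plus, ?_, ?_⟩
  · rw [T.face_eq_cellFace .plus φ, mem_cellFace_iff, mem_cell_iff]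
    refine ⟨fun f => ?_, ?_⟩
    · rw [height_convex_comb _ _ _ _ _ (by norm_num)]
      have := hnn .plus .minus f
      have := hnn .plus .plus f
      positivity
    · rw [height_convex_comb _ _ _ _ _ (by norm_num), h0,
        (T.mem_cellFace_iff.1 (hmem .plus .minus)).2]
      norm_num
  · intro s f hf
    rw [height_convex_comb _ _ _ _ _ (by norm_num)]
    have h1 := hpos s f hf
    have h2 := hnn s .minus f
    have h3 := hnn s .plus f
    cases s <;> linarith

/-- Relatively interior points of the contact faces are interior points of the domain. -/
theorem face_interior_mem_Ω {φ : κ} {x : E} (hx : x ∈ T.face φ)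
    (hpos : ∀ s, ∀ f, f ≠ T.sideFace s φ → 0 < T.height (T.side s φ) f x) : x ∈ T.Ω := by
  have h0 : ∀ s, T.height (T.side s φ) (T.sideFace s φ) x = 0 := by
    intro s
    rw [T.face_eq_cellFace s φ] at hx
    exact (T.mem_cellFace_iff.1 hx).2
  have hopen : ∀ s, {y | ∀ f, f ≠ T.sideFace s φ → 0 < T.height (T.side s φ) f y} ∈ nhds x :=
    fun s => (T.isOpen_setOf_height_pos (T.side s φ) (· ≠ T.sideFace s φ)).mem_nhds (hpos s)
  obtain ⟨r, hr, hball⟩ := Metric.mem_nhds_iff.1 (Filter.inter_mem (hopen .minus) (hopen .plus))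
  have hposb : ∀ y ∈ Metric.ball x r, ∀ s, ∀ f, f ≠ T.sideFace s φ →
      0 < T.height (T.side s φ) f y := by
    intro y hy s
    cases s
    · exact (hball hy).1
    · exact (hball hy).2
  have hmem : ∀ y ∈ Metric.ball x r, ∀ s, 0 ≤ T.height (T.side s φ) (T.sideFace s φ) y →
      y ∈ T.cell (T.side s φ) := by
    intro y hy s h
    refine T.mem_cell_iff.2 fun f => ?_
    by_cases hf : f = T.sideFace s φ
    · rwa [hf]
    · exact (hposb y hy s f hf).le
  have hint : ∀ y ∈ Metric.ball x r, ∀ s, 0 < T.height (T.side s φ) (T.sideFace s φ) y →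
      y ∈ interior (T.cell (T.side s φ)) := by
    intro y hy s h
    refine T.mem_interior_cell fun f => ?_
    by_cases hf : f = T.sideFace s φ
    · rwa [hf]
    · exact hposb y hy s f hf
  rw [← T.interior_closure, mem_interior_iff_mem_nhds]
  refine Filter.mem_of_superset (Metric.ball_mem_nhds x hr) fun y hy => ?_
  by_contra hcon
  have hneg : ∀ s, T.height (T.side s φ) (T.sideFace s φ) y < 0 := by
    intro s
    by_contra! h
    exact hcon (T.cell_subset_closure _ (hmem y hy s h))
  have hy' : (2 : ℝ) • x + (-1 : ℝ) • y ∈ Metric.ball x r := by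
    rw [Metric.mem_ball, dist_eq_norm] at hy ⊢
    rw [show (2 : ℝ) • x + (-1 : ℝ) • y - x = -(y - x) by module, norm_neg]
    exact hy
  have hrefl : ∀ s, (2 : ℝ) • x + (-1 : ℝ) • y ∈ interior (T.cell (T.side s φ)) := by
    intro s
    refine hint _ hy' s ?_
    rw [height_convex_comb _ _ _ _ _ (by norm_num), h0]
    linarith [hneg s]
  exact (T.nonoverlapping _ _ (T.side_ne φ)).le_bot ⟨hrefl .minus, hrefl .plus⟩

/-- A face has positive area near each of its relatively interior points. -/
theorem face_inter_pos {K : ι} {f : RefFace (T.kind K)} {x : E} (hx : T.height K f x = 0)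
    (hpos : ∀ f', f' ≠ f → 0 < T.height K f' x) {N : Set E} (hN : N ∈ nhds x) :
    0 < (μHE[2] : Measure E) (T.cellFace K f ∩ N) := by
  set s := LinearMap.ker (T.height K f).linear with hs
  have hsub : ∀ z : s, T.height K f ((z : E) + x) = 0 := by
    intro z
    rw [← T.linear_height_sub hx, add_sub_cancel_right]
    exact z.2
  have hrank : Module.finrank ℝ s = 2 := T.finrank_ker_height K f
  have hi : Isometry fun z : s => (z : E) + x := by
    intro y z
    simp
    rfl
  have hle : (μHE[2] : Measure s) ((fun z : s => (z : E) + x) ⁻¹' (T.cellFace K f ∩ N))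
      ≤ μHE[2] (T.cellFace K f ∩ N) := by
    rw [hi.euclideanHausdorffMeasure_preimage]
    exact measure_mono inter_subset_left
  refine lt_of_lt_of_le ?_ hle
  rw [← hrank, InnerProductSpace.euclideanHausdorffMeasure_eq_volume]
  refine Measure.measure_pos_of_mem_nhds (x := (0 : s)) _ ?_
  have hcont : Filter.Tendsto (fun z : s => (z : E) + x) (nhds 0) (nhds x) := by
    have : Continuous fun z : s => (z : E) + x := by fun_prop
    simpa using this.tendsto 0
  have hN' := hcont.eventually (Filter.inter_mem hN
    ((T.isOpen_setOf_height_pos K (· ≠ f)).mem_nhds hpos))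
  filter_upwards [hN'] with z hz
  refine ⟨T.mem_cellFace_iff.2 ⟨T.mem_cell_iff.2 fun f' => ?_, hsub z⟩, hz.1⟩
  by_cases hf : f' = f
  · rw [hf, hsub]
  · exact (hz.2 f' hf).le

/-- A smooth field cut off outside of the element `K` has a trace from inside `K`. -/
theorem isTrace_of_smooth (K : ι) (S : Set E) {v : E → E} (hv : ContDiff ℝ (⊤ : ℕ∞) v)
    {w : Pair T.O} (h1 : w.1 =ᵐ[volume.restrict T.O] (T.cell K).indicator v)
    (h2 : ∀ j, w.2 j =ᵐ[volume.restrict T.O] (T.cell K).indicator fun x => fderiv ℝ v x (e j))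
    {g : L2Surf S} (hg : g =ᵐ[μHE[2].restrict S] v) : IsTrace (T.cell K) S w g := by
  refine Submodule.le_topologicalClosure _ ⟨v, hv, ?_, fun j => ?_, hg⟩
  · refine (LpToLpRestrictCLM_coeFn ℝ (T.cell K) w.1).trans ?_
    refine Filter.EventuallyEq.trans (ae_restrict_of_ae h1) ?_
    exact indicator_ae_eq_restrict (T.measurableSet_cell K)
  · refine (LpToLpRestrictCLM_coeFn ℝ (T.cell K) (w.2 j)).trans ?_
    refine Filter.EventuallyEq.trans (ae_restrict_of_ae (h2 j)) ?_
    exact indicator_ae_eq_restrict (T.measurableSet_cell K)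

theorem restr_eq_zero {K K' : ι} (h : K' ≠ K) {v : E → E} {u : L2 T.O}
    (hu : u =ᵐ[volume.restrict T.O] (T.cell K).indicator v) : restr T.O (T.cell K') u = 0 := by
  refine Lp.ext ?_
  refine (LpToLpRestrictCLM_coeFn ℝ (T.cell K') u).trans ?_
  refine Filter.EventuallyEq.trans ?_ (Lp.coeFn_zero _ _ _).symm
  refine Filter.EventuallyEq.trans (ae_restrict_of_ae hu) ?_
  have hnull : ∀ᵐ x : E, x ∉ T.cell K ∩ T.cell K' := by
    rw [ae_iff]
    simpa using T.volume_cell_inter h.symm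
  filter_upwards [ae_restrict_of_ae (ae_restrict_of_ae hnull),
    ae_restrict_mem (T.measurableSet_cell K')] with x hx hx'
  rw [indicator_of_notMem (fun hc => hx ⟨hc, hx'⟩)]
  rfl

theorem isTrace_zero_of_ne {K K' : ι} (h : K' ≠ K) (S : Set E) {v : E → E}
    {dv : Fin 3 → E → E} {w : Pair T.O} (h1 : w.1 =ᵐ[volume.restrict T.O] (T.cell K).indicator v)
    (h2 : ∀ j, w.2 j =ᵐ[volume.restrict T.O] (T.cell K).indicator (dv j)) :
    IsTrace (T.cell K') S w 0 := by
  unfold IsTrace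
  rw [T.restr_eq_zero h h1]
  simp only [T.restr_eq_zero h (h2 _)]
  exact zero_mem (smoothTraceGraph T.O (T.cell K') S).topologicalClosure

/-- Cutting off a smooth field outside of an element gives a weakly differentiable field in the
cut domain, provided that the support meets the boundary of the element only in the contact
surface. -/
theorem hasWeakPartial_indicator {K : ι} {v : E → E} (hv : ContDiff ℝ (⊤ : ℕ∞) v)
    (hsupp : tsupport v ∩ frontier (T.cell K) ⊆ T.Γf) (j : Fin 3) {u du : L2 T.O}
    (hu : u =ᵐ[volume.restrict T.O] (T.cell K).indicator v)
    (hdu : du =ᵐ[volume.restrict T.O] (T.cell K).indicator fun x => fderiv ℝ v x (e j)) :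
    HasWeakPartial T.O j u du := by
  intro ψ hψ hψc hψO
  have hdψ : Continuous fun x => fderiv ℝ ψ x := hψ.continuous_fderiv (by simp)
  have hdv : Continuous fun x => fderiv ℝ v x := hv.continuous_fderiv (by simp)
  have hK := T.measurableSet_cell K
  have e1 : ∫ x in T.O, fderiv ℝ ψ x (e j) • u x
      = ∫ x, fderiv ℝ ψ x (e j) • (T.cell K).indicator v x := by
    refine Eq.trans ?_ (setIntegral_eq_integral_of_forall_compl_eq_zero (s := T.O) ?_)
    · exact integral_congr_ae (hu.mono fun x hx => by simp only [hx])
    · intro x hx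
      have : fderiv ℝ ψ x = 0 := by
        by_contra h
        exact hx (hψO (support_fderiv_subset ℝ h))
      simp [this]
  have e2 : ∫ x in T.O, ψ x • du x
      = ∫ x, ψ x • (T.cell K).indicator (fun x => fderiv ℝ v x) x (e j) := by
    refine Eq.trans ?_ (setIntegral_eq_integral_of_forall_compl_eq_zero (s := T.O) ?_)
    · refine integral_congr_ae (hdu.mono fun x hx => ?_)
      simp only [hx]
      by_cases hx : x ∈ T.cell K <;> simp [hx]
    · intro x hx
      have : ψ x = 0 := by
        by_contra h
        exact hx (hψO (subset_tsupport _ h))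
      simp [this]
  have hind : ∀ {g : E → E}, Continuous g → HasCompactSupport g →
      Integrable ((T.cell K).indicator g) := fun hg hgc =>
    (hg.integrable_of_hasCompactSupport hgc).indicator hK
  have key := integral_bilinear_hasFDerivAt_right_eq_neg_left_of_integrable (μ := volume)
    (f := ψ) (f' := fun x => fderiv ℝ ψ x) (g := (T.cell K).indicator v)
    (g' := (T.cell K).indicator fun x => fderiv ℝ v x) (v := e j)
    (B := ContinuousLinearMap.lsmul ℝ ℝ) ?_ ?_ ?_ ?_ ?_
  · simp only [ContinuousLinearMap.lsmul_apply] at key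
    rw [e1, e2, key, neg_neg]
  · refine (hind (g := fun x => fderiv ℝ ψ x (e j) • v x) (by fun_prop)
      ((hψc.fderiv_apply (𝕜 := ℝ) (e j)).smul_right)).congr (Filter.Eventually.of_forall ?_)
    intro x
    by_cases hx : x ∈ T.cell K <;> simp [hx]
  · refine (hind (g := fun x => ψ x • fderiv ℝ v x (e j)) (by fun_prop)
      hψc.smul_right).congr (Filter.Eventually.of_forall ?_)
    intro x
    by_cases hx : x ∈ T.cell K <;> simp [hx]
  · refine (hind (g := fun x => ψ x • v x) (by fun_prop)
      hψc.smul_right).congr (Filter.Eventually.of_forall ?_)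
    intro x
    by_cases hx : x ∈ T.cell K <;> simp [hx]
  · exact fun x _ => ((hψ.differentiable (by simp)) x).hasFDerivAt
  · intro x hx
    have hxO := hψO hx
    have hvd := ((hv.differentiable (by simp)) x).hasFDerivAt
    by_cases hxi : x ∈ interior (T.cell K)
    · rw [indicator_of_mem (interior_subset hxi)]
      refine hvd.congr_of_eventuallyEq ?_
      filter_upwards [mem_interior_iff_mem_nhds.1 hxi] with y hy
      rw [indicator_of_mem hy]
    · have hzero : (T.cell K).indicator v =ᶠ[nhds x] fun _ => 0 := by
        by_cases hxc : x ∈ T.cell K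
        · have hxs : x ∉ tsupport v := fun hs =>
            hxO.2 (hsupp ⟨hs, subset_closure hxc, hxi⟩)
          filter_upwards [(isClosed_tsupport v).isOpen_compl.mem_nhds hxs] with y hy
          have : v y = 0 := image_eq_zero_of_notMem_tsupport hy
          by_cases hyc : y ∈ T.cell K <;> simp [hyc, this]
        · filter_upwards [(T.isClosed_cell K).isOpen_compl.mem_nhds hxc] with y hy
          rw [indicator_of_notMem hy]
      have hval : (T.cell K).indicator (fun x => fderiv ℝ v x) x = 0 := by
        by_cases hxc : x ∈ T.cell K
        · have hxs : x ∉ tsupport v := fun hs =>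
            hxO.2 (hsupp ⟨hs, subset_closure hxc, hxi⟩)
          rw [indicator_of_mem hxc]
          by_contra h
          exact hxs (support_fderiv_subset ℝ h)
        · rw [indicator_of_notMem hxc]
      rw [hval]
      exact (hasFDerivAt_const (0 : E) x).congr_of_eventuallyEq hzero

/-- A displacement that jumps across a single face by a nonnegative multiple of a given vector. -/
theorem exists_displacement [Fintype κ] (φ : κ) (c : E) : ∃ w ∈ T.U, ∃ χ : E → ℝ,
    Continuous χ ∧ (∀ x, 0 ≤ χ x) ∧ 0 < (μHE[2] : Measure E) (T.face φ ∩ {x | 0 < χ x}) ∧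
    (T.sideTrace .plus φ w =ᵐ[μHE[2].restrict (T.face φ)] fun x => χ x • c) ∧
    T.sideTrace .minus φ w = 0 ∧ ∀ s φ', φ' ≠ φ → T.sideTrace s φ' w = 0 := by
  obtain ⟨x₀, hx₀, hpos⟩ := T.exists_face_interior φ
  have hΩ := T.face_interior_mem_Ω hx₀ hpos
  set K := T.side .plus φ with hKdef
  set f := T.sideFace .plus φ with hfdef
  have hx₀' : T.height K f x₀ = 0 := (T.mem_cellFace_iff.1 hx₀).2
  set N := T.Ω ∩ {x | ∀ f', f' ≠ f → 0 < T.height K f' x} with hNdef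
  have hN : N ∈ nhds x₀ := Filter.inter_mem (T.isOpen_Ω.mem_nhds hΩ)
    ((T.isOpen_setOf_height_pos K (· ≠ f)).mem_nhds (hpos .plus))
  obtain ⟨χ, hχN, hχc, hχ, hχr, hχ1⟩ := exists_contDiff_tsupport_subset (n := ⊤) hN
  have hχ0 : ∀ x, 0 ≤ χ x := fun x => (hχr ⟨x, rfl⟩).1
  set v : E → E := fun x => χ x • c with hvdef
  have hv : ContDiff ℝ (⊤ : ℕ∞) v := hχ.smul contDiff_const
  have hdv : Continuous fun x => fderiv ℝ v x := hv.continuous_fderiv (by simp)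
  have hvN : ∀ x, x ∉ N → v x = 0 := fun x hx => by
    have : χ x = 0 := image_eq_zero_of_notMem_tsupport fun h => hx (hχN h)
    simp [hvdef, this]
  have htv : tsupport v ⊆ N := by
    refine Subset.trans (closure_mono ?_) hχN
    intro x hx
    by_contra h
    exact hx (by simp [hvdef, Function.notMem_support.1 h])
  have hm : ∀ {g : E → E}, Continuous g →
      MemLp ((T.cell K).indicator g) 2 (volume.restrict T.O) := fun hg => by
    rw [memLp_indicator_iff_restrict (T.measurableSet_cell K)]
    exact T.memLp_cell K hg
  have hm1 := hm hv.continuous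
  have hm2 : ∀ j, MemLp ((T.cell K).indicator fun x => fderiv ℝ v x (e j)) 2
    (volume.restrict T.O) := fun j => hm (by fun_prop)
  set w : Pair T.O := (hm1.toLp _, fun j => (hm2 j).toLp _) with hw
  have h1 : w.1 =ᵐ[volume.restrict T.O] (T.cell K).indicator v := hm1.coeFn_toLp
  have h2 : ∀ j, w.2 j =ᵐ[volume.restrict T.O] (T.cell K).indicator fun x => fderiv ℝ v x (e j) :=
    fun j => (hm2 j).coeFn_toLp
  have hzero : ∀ K' f', T.cellFace K' f' ≠ T.face φ →
      IsTrace (T.cell K') (T.cellFace K' f') w 0 := by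
    intro K' f' hne
    by_cases hK : K' = K
    · subst hK
      refine T.isTrace_of_smooth K _ hv h1 h2 ?_
      refine (Lp.coeFn_zero _ _ _).trans ?_
      refine (ae_restrict_iff' (T.measurableSet_cellFace K f')).2 (Filter.Eventually.of_forall ?_)
      intro x hx
      refine (hvN x fun hxN => ?_).symm
      have hff : f' ≠ f := by
        rintro rfl
        exact hne rfl
      exact (hxN.2 f' hff).ne' (T.mem_cellFace_iff.1 hx).2
    · exact T.isTrace_zero_of_ne hK _ h1 h2
  have hface : IsTrace (T.cell K) (T.face φ) w ((T.memLp_cellFace K f hv).toLp v) :=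
    T.isTrace_of_smooth K _ hv h1 h2 (MemLp.coeFn_toLp _)
  have hwU : w ∈ T.U := by
    refine ⟨fun j => T.hasWeakPartial_indicator hv ?_ j h1 (h2 j), fun K' f' => ?_⟩
    · rintro x ⟨hxs, hxf⟩
      refine T.face_subset φ ?_
      have hxc : x ∈ T.cell K := (T.isClosed_cell K).frontier_subset hxf
      refine T.mem_cellFace_iff.2 ⟨hxc, ?_⟩
      by_contra h0
      refine hxf.2 (T.mem_interior_cell fun f' => ?_)
      by_cases hf : f' = f
      · rw [hf]
        exact lt_of_le_of_ne (T.mem_cell_iff.1 hxc f) (Ne.symm h0)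
      · exact (htv hxs).2 f' hf
    · by_cases hne : T.cellFace K' f' = T.face φ
      · by_cases hK : K' = K
        · subst hK
          refine ⟨(T.memLp_cellFace K f' hv).toLp v,
            T.isTrace_of_smooth K _ hv h1 h2 (MemLp.coeFn_toLp _), ?_⟩
          filter_upwards [(T.memLp_cellFace K f' hv).coeFn_toLp] with x hx hxu
          rw [hx]
          refine hvN x fun hxN => ?_
          exact (T.Γu_subset hxu).2 (by rw [T.isOpen_Ω.interior_eq]; exact hxN.1)
        · refine ⟨0, T.isTrace_zero_of_ne hK _ h1 h2, ?_⟩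
          filter_upwards [Lp.coeFn_zero E 2 (μHE[2].restrict (T.cellFace K' f'))] with x hx _
          rw [hx, Pi.zero_apply]
      · refine ⟨0, hzero K' f' hne, ?_⟩
        filter_upwards [Lp.coeFn_zero E 2 (μHE[2].restrict (T.cellFace K' f'))] with x hx _
        rw [hx, Pi.zero_apply]
  refine ⟨w, hwU, χ, hχ.continuous, hχ0, ?_, ?_, ?_, fun s φ' hφ' => ?_⟩
  · refine T.face_inter_pos hx₀' (hpos .plus) ?_
    exact (isOpen_lt continuous_const hχ.continuous).mem_nhds (by simp [hχ1])
  · rw [T.sideTrace_eq hface]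
    exact MemLp.coeFn_toLp _
  · exact T.sideTrace_eq (T.isTrace_zero_of_ne (T.side_ne φ) _ h1 h2)
  · refine T.sideTrace_eq ?_
    have := hzero (T.side s φ') (T.sideFace s φ')
    rw [← T.face_eq_cellFace s φ'] at this
    exact this fun h => hφ' (T.face_injective h)

/-- The form `b` separates the piecewise constant tractions. -/
theorem exists_b_pos [Fintype κ] {μ : L2Surf T.Γf} (hμ : μ ∈ T.Mh) (h0 : μ ≠ 0) :
    ∃ w ∈ T.U, 0 < T.b μ w := by
  have hex : ∃ φ, ∃ c : E, c ≠ 0 ∧ ∀ᵐ x ∂(μHE[2].restrict (T.face φ)), μ x = c := by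
    by_contra! hcon
    refine h0 (Lp.ext ?_)
    refine Filter.EventuallyEq.trans ?_ (Lp.coeFn_zero _ _ _).symm
    refine (ae_restrict_iUnion_iff T.face _).2 fun φ => ?_
    obtain ⟨c, hc⟩ := hμ φ
    by_cases hc0 : c = 0
    · subst hc0
      exact hc
    · exact absurd hc (Filter.not_eventually.2 (hcon φ c hc0))
  obtain ⟨φ, c, hc0, hc⟩ := hex
  obtain ⟨w, hw, χ, hχ, hχ0, hχpos, hplus, hminus, hother⟩ := T.exists_displacement φ c
  refine ⟨w, hw, ?_⟩
  rw [b_eq_sum, Finset.sum_eq_single φ]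
  · rw [hminus, sub_zero, L2.inner_def]
    have hae : (fun x => ⟪T.onFace μ φ x, T.sideTrace .plus φ w x⟫)
        =ᵐ[μHE[2].restrict (T.face φ)] fun x => χ x * ‖c‖ ^ 2 := by
      filter_upwards [T.coeFn_onFace μ φ, hc, hplus] with x h1 h2 h3
      rw [h1, h2, h3, inner_smul_right, real_inner_self_eq_norm_sq]
    rw [integral_congr_ae hae, integral_pos_iff_support_of_nonneg]
    · have hm : MeasurableSet (T.face φ) := (T.isClosed_face φ).measurableSet
      rw [Measure.restrict_apply' hm]
      refine hχpos.trans_le (measure_mono ?_)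
      rintro x ⟨hx, hx'⟩
      refine ⟨?_, hx⟩
      have : 0 < χ x * ‖c‖ ^ 2 := mul_pos hx' (by positivity)
      exact this.ne'
    · intro x
      have := hχ0 x
      positivity
    · exact (L2.integrable_inner _ _).congr hae
  · intro φ' _ hne
    rw [hother _ _ hne, hother _ _ hne, sub_zero, inner_zero_right]
  · simp

theorem Uh_le_U : T.Uh ≤ T.U :=
  sup_le (fun _ hw => hw.1) (Submodule.span_le.2 fun _ hw => hw.1)

theorem pairing_eq_b [Fintype κ] (μ : L2Surf T.Γf) {g : L2Surf T.Γf} {u : Pair T.O}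
    (h : g =ᵐ[μHE[2].restrict T.Γf] T.jump u) : T.pairing μ g = T.b μ u :=
  integral_congr_ae (h.mono fun x hx => by simp only [hx])

theorem halfNorm_nonneg [Fintype κ] (g : L2Surf T.Γf) : 0 ≤ T.halfNorm g :=
  Real.sInf_nonneg (by rintro r ⟨u, -, -, rfl⟩; exact T.normU_nonneg u)

/-- The duality bound of the pairing by the norm of `H^{1/2}`. -/
theorem pairing_le [Fintype κ] {μ g : L2Surf T.Γf} {B : ℝ} (hB0 : 0 ≤ B)
    (hB : ∀ w ∈ T.U, |T.b μ w| ≤ B * T.normU w) (hg : g ∈ T.jumpSpace) :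
    T.pairing μ g ≤ B * T.halfNorm g := by
  obtain ⟨u₀, hu₀, hgu₀⟩ := hg
  rcases hB0.eq_or_lt with rfl | hBpos
  · rw [T.pairing_eq_b μ hgu₀, zero_mul]
    simpa using (le_abs_self _).trans (hB u₀ hu₀)
  · rw [← div_le_iff₀' hBpos]
    refine le_csInf ⟨_, u₀, hu₀, hgu₀, rfl⟩ ?_
    rintro r ⟨u, hu, hgu, rfl⟩
    rw [div_le_iff₀' hBpos, T.pairing_eq_b μ hgu]
    exact (le_abs_self _).trans (hB u hu)

theorem bddAbove_normM [Fintype κ] [Finite ι] [Nonempty ι] (μ : L2Surf T.Γf) :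
    BddAbove {r | ∃ g ∈ T.jumpSpace, r = T.pairing μ g / T.halfNorm g} := by
  obtain ⟨B, hB0, hB⟩ := T.exists_b_bound μ
  refine ⟨B, ?_⟩
  rintro r ⟨g, hg, rfl⟩
  exact div_le_of_le_mul₀ (T.halfNorm_nonneg g) hB0 (T.pairing_le hB0 hB hg)

theorem normM_pos [Fintype κ] [Finite ι] [Nonempty ι] {μ : L2Surf T.Γf} (hμ : μ ∈ T.Mh)
    (h0 : μ ≠ 0) : 0 < T.normM μ := by
  obtain ⟨B, hB0, hB⟩ := T.exists_b_bound μ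
  obtain ⟨w, hw, hpos⟩ := T.exists_b_pos hμ h0
  have hgw : (T.memLp_jump w).toLp _ =ᵐ[μHE[2].restrict T.Γf] T.jump w := MemLp.coeFn_toLp _
  have hg : (T.memLp_jump w).toLp _ ∈ T.jumpSpace := ⟨w, hw, hgw⟩
  have hp : 0 < T.pairing μ ((T.memLp_jump w).toLp _) := by rwa [T.pairing_eq_b μ hgw]
  have hle := T.pairing_le hB0 hB hg
  have hh : 0 < T.halfNorm ((T.memLp_jump w).toLp _) := by
    refine lt_of_le_of_ne (T.halfNorm_nonneg _) fun h => ?_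
    rw [← h, mul_zero] at hle
    exact hle.not_gt hp
  exact (div_pos hp hh).trans_le (le_csSup (T.bddAbove_normM μ) ⟨_, hg, rfl⟩)

/-- Displacements almost attain the norm of a traction. -/
theorem exists_almost_maximizer [Fintype κ] {μ : L2Surf T.Γf}
    (hM : 0 < T.normM μ) {a : ℝ} (ha0 : 0 ≤ a) (ha : a < T.normM μ) :
    ∃ u ∈ T.U, 0 < T.b μ u ∧ a * T.normU u ≤ T.b μ u := by
  have hne : {r | ∃ g ∈ T.jumpSpace, r = T.pairing μ g / T.halfNorm g}.Nonempty := by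
    by_contra h
    rw [not_nonempty_iff_eq_empty] at h
    rw [normM, h, Real.sSup_empty] at hM
    exact hM.false
  obtain ⟨_, ⟨g, ⟨u₀, hu₀, hgu₀⟩, rfl⟩, hlt⟩ := exists_lt_of_lt_csSup hne ha
  have hh : 0 < T.halfNorm g := by
    refine lt_of_le_of_ne (T.halfNorm_nonneg _) fun h => ?_
    rw [← h, div_zero] at hlt
    exact hlt.not_ge ha0
  rw [lt_div_iff₀ hh] at hlt
  have hp : 0 < T.pairing μ g := (mul_nonneg ha0 hh.le).trans_lt hlt
  rcases ha0.eq_or_lt with rfl | hapos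
  · exact ⟨u₀, hu₀, by rwa [← T.pairing_eq_b μ hgu₀],
      by rw [zero_mul, ← T.pairing_eq_b μ hgu₀]; exact hp.le⟩
  have hlt' : T.halfNorm g < T.pairing μ g / a := by rwa [lt_div_iff₀' hapos]
  obtain ⟨_, ⟨u, hu, hgu, rfl⟩, hlu⟩ :=
    exists_lt_of_csInf_lt (s := {r | ∃ u ∈ T.U, g =ᵐ[μHE[2].restrict T.Γf] T.jump u ∧
      r = T.normU u}) ⟨_, u₀, hu₀, hgu₀, rfl⟩ hlt'
  rw [lt_div_iff₀' hapos] at hlu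
  rw [T.pairing_eq_b μ hgu] at hp hlu
  exact ⟨u, hu, hp, hlu.le⟩

end FaultMesh

end FaultFEM

end

theorem mainTheorem1 {ι κ : Type*} [Fintype ι] [Fintype κ] (T : FaultFEM.FaultMesh ι κ)
    (C : ℝ) (hC : 0 < C) (Pih : T.U →ₗ[ℝ] T.Uh)
    (hPih_jump : ∀ u : T.U, ∀ μ ∈ T.Mh,
      T.b μ ((Pih u : FaultFEM.Pair T.O) - (u : FaultFEM.Pair T.O)) = 0)
    (hPih_bound : ∀ u : T.U,
      T.normU (Pih u : FaultFEM.Pair T.O) ≤ C * T.normU (u : FaultFEM.Pair T.O)) :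
    T.InfSup C⁻¹ := by
  refine ⟨inv_pos.2 hC, le_iInf ?_⟩
  rintro ⟨μ, hμ, hμ0⟩
  obtain ⟨w₀, -, hw₀⟩ := T.exists_b_pos hμ hμ0
  have hκ : Nonempty κ := by
    by_contra h
    rw [not_nonempty_iff] at h
    simp [T.b_eq_sum] at hw₀
  have : Nonempty ι := hκ.map (T.side .plus)
  have hM := T.normM_pos hμ hμ0
  obtain ⟨B, -, hB⟩ := T.exists_b_bound μ
  have hkey : ∀ θ : ℝ, 0 ≤ θ → θ < C⁻¹ → ∃ v, (v ∈ T.Uh ∧ v ≠ 0) ∧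
      θ ≤ T.b μ v / (T.normU v * T.normM μ) := by
    intro θ hθ0 hθ
    have hθC : θ * C < 1 := by rwa [← lt_div_iff₀ hC, one_div]
    obtain ⟨u, hu, hbu, hle⟩ := T.exists_almost_maximizer hM (a := θ * C * T.normM μ)
      (by positivity) (by nlinarith)
    have hvU := T.Uh_le_U (Pih ⟨u, hu⟩).2
    have hbv : T.b μ (Pih ⟨u, hu⟩ : FaultFEM.Pair T.O) = T.b μ u := by
      have := hPih_jump ⟨u, hu⟩ μ hμ
      rwa [T.b_sub μ hvU hu, sub_eq_zero] at this
    have hbound := hPih_bound ⟨u, hu⟩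
    have hnorm : 0 < T.normU (Pih ⟨u, hu⟩ : FaultFEM.Pair T.O) := by
      refine lt_of_le_of_ne (T.normU_nonneg _) fun h => ?_
      have := (le_abs_self _).trans (hB _ hvU)
      rw [← h, mul_zero, hbv] at this
      exact this.not_gt hbu
    refine ⟨_, ⟨(Pih ⟨u, hu⟩).2, fun h => ?_⟩, ?_⟩
    · rw [h] at hnorm
      simp [FaultFEM.FaultMesh.normU] at hnorm
    · rw [le_div_iff₀ (by positivity), hbv]
      refine le_trans ?_ hle
      have := mul_le_mul_of_nonneg_left hbound (mul_nonneg hθ0 hM.le)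
      linarith
  refine le_of_forall_lt fun a ha => ?_
  obtain ⟨q, hq1, hq2⟩ := EReal.lt_iff_exists_real_btwn.1 ha
  obtain ⟨v, hv, hle⟩ := hkey (max q 0) (le_max_right _ _)
    (max_lt (by exact_mod_cast hq2) (inv_pos.2 hC))
  refine hq1.trans_le (le_trans ?_ (le_iSup _ ⟨v, hv⟩))
  exact EReal.coe_le_coe_iff.2 ((le_max_left _ _).trans hle)
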